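/- Let $d\in\mathbb N$. Write $\langle F,\varphi\rangle$ for the bracket between tempered distributions and Schwartz functions that extends $\int F\,\overline{\varphi}$ (conjugate-linear in $\varphi$), and $(F\otimes G)(z,w)=F(z)G(w)$. For $f,g\in\mathcal S(\mathbb R^n)$ let $$W(f,g)(x,\xi)=\int_{\mathbb R^n} f\big(x+\tfrac t2\big)\,\overline{g\big(x-\tfrac t2\big)}\,e^{-2\pi i t\cdot\xi}\,dt$$ be the cross-Wigner distribution; for $F,G\in\mathcal S'(\mathbb R^n)$, $W(F,G)\in\mathcal S'(\mathbb R^{2n})$ is the partial Fourier transform $t\to\xi$ of $(F\otimes\overline G)(x+\frac t2,x-\frac t2)$. Put $Wf=W(f,f)$. For $F\in\mathcal S'(\mathbb R^{4d})$ put $\mathfrak T_pF(x,\xi,y,\eta)=F(x,y,\xi,-\eta)$ with $x,\xi,y,\eta\in\mathbb R^d$. Let $T:\mathcal S(\mathbb R^d)\to\mathcal S'(\mathbb R^d)$ be a continuous linear operator. Then $T$ has a unique Schwartz kernel, i.e. there is a unique $k_T\in\mathcal S'(\mathbb R^{2d})$ with $\langle Tf,g\rangle=\langle k_T,g\otimes\overline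 f\rangle$ for all $f,g\in\mathcal S(\mathbb R^d)$, and $T$ has a unique Wigner kernel, i.e. there is a unique $k\in\mathcal S'(\mathbb R^{4d})$ with $$\langle W(Tf,Tg),W(u,v)\rangle=\langle k,W(u,v)\otimes\overline{W(f,g)}\rangle\qquad\text{for all } f,g,u,v\in\mathcal S(\mathbb R^d).$$ Moreover: 1. $\langle k,Wf\otimes Wg\rangle\ge 0$ (real and nonnegative) for all $f,g\in\mathcal S(\mathbb R^d)$; 2. $k=\mathfrak T_p\,Wk_T$; 3. $k\in L^2(\mathbb R^{4d})$ if and only if $k_T\in L^2(\mathbb R^{2d})$; 4. $k\in\mathcal S(\mathbb R^{4d})$ if and only if $k_T\in\mathcal S(\mathbb R^{2d})$. -/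

import Mathlib

namespace WignerKernel

open MeasureTheory SchwartzMap
open scoped FourierTransform LineDeriv ContDiff

theorem schwartz_decay {W F : Type} [NormedAddCommGroup W] [NormedSpace ℝ W]
    [NormedAddCommGroup F] [NormedSpace ℝ F] (Φ : 𝓢(W, F)) (k : ℕ) :
    ∃ C : ℝ, 0 ≤ C ∧ ∀ x, (1 + ‖x‖) ^ k * ‖Φ x‖ ≤ C := by
  refine ⟨2 ^ k * ((Finset.Iic (k, 0)).sup fun m => SchwartzMap.seminorm ℝ m.1 m.2) Φ,
    by positivity, fun x => ?_⟩
  have := one_add_le_sup_seminorm_apply (𝕜 := ℝ) (m := (k, 0)) le_rfl le_rfl Φ x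
  rwa [norm_iteratedFDeriv_zero] at this

theorem schwartz_translate_sub {W F : Type} [NormedAddCommGroup W] [NormedSpace ℝ W]
    [NormedAddCommGroup F] [NormedSpace ℝ F] (Φ : 𝓢(W, F)) (k : ℕ) :
    ∃ C : ℝ, 0 ≤ C ∧ ∀ p q : W, ‖q - p‖ ≤ 1 →
      (1 + ‖p‖) ^ k * ‖Φ q - Φ p‖ ≤ C * ‖q - p‖ := by
  obtain ⟨C, hC, h⟩ := schwartz_decay (fderivCLM ℝ W F Φ) k
  refine ⟨2 ^ k * C, by positivity, fun p q hpq => ?_⟩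
  have hp : 0 < (1 + ‖p‖) ^ k := by positivity
  have key : ∀ x ∈ Metric.closedBall p 1, ‖fderiv ℝ Φ x‖ ≤ 2 ^ k * C / (1 + ‖p‖) ^ k := by
    intro x hx
    rw [le_div_iff₀ hp]
    have h1 : 1 + ‖p‖ ≤ 2 * (1 + ‖x‖) := by
      have : ‖p‖ ≤ ‖x‖ + ‖x - p‖ := by
        have := norm_sub_le x (x - p); simpa using this
      rw [mem_closedBall_iff_norm] at hx
      linarith [norm_nonneg x]
    have h2 : (1 + ‖p‖) ^ k ≤ 2 ^ k * (1 + ‖x‖) ^ k := by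
      rw [← mul_pow]; gcongr
    have h3 := h x
    rw [fderivCLM_apply] at h3
    calc ‖fderiv ℝ Φ x‖ * (1 + ‖p‖) ^ k ≤ ‖fderiv ℝ Φ x‖ * (2 ^ k * (1 + ‖x‖) ^ k) := by gcongr
      _ = 2 ^ k * ((1 + ‖x‖) ^ k * ‖fderiv ℝ Φ x‖) := by ring
      _ ≤ _ := by gcongr
  have := (convex_closedBall p 1).norm_image_sub_le_of_norm_fderiv_le (𝕜 := ℝ) (f := Φ)
    (fun x _ => Φ.differentiableAt) key (Metric.mem_closedBall_self zero_le_one)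
    (y := q) (by rw [mem_closedBall_iff_norm]; exact hpq)
  calc _ ≤ (1 + ‖p‖) ^ k * (2 ^ k * C / (1 + ‖p‖) ^ k * ‖q - p‖) := by gcongr
    _ = _ := by field_simp

theorem schwartz_taylor {W : Type} [NormedAddCommGroup W] [NormedSpace ℝ W] (n k : ℕ) :
    ∀ {F : Type} [NormedAddCommGroup F] [NormedSpace ℝ F] (Φ : 𝓢(W, F)),
    ∃ C : ℝ, 0 ≤ C ∧ ∀ h : W, ‖h‖ ≤ 1 → ∀ p : W,
      (1 + ‖p‖) ^ k * ‖iteratedFDeriv ℝ n (fun p => Φ (p + h) - Φ p - fderiv ℝ Φ p h) p‖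
        ≤ C * ‖h‖ ^ 2 := by
  induction n with
  | zero =>
    intro F _ _ Φ
    obtain ⟨C, hC, hb⟩ := schwartz_translate_sub (fderivCLM ℝ W F Φ) k
    refine ⟨C, hC, fun h hh p => ?_⟩
    rw [norm_iteratedFDeriv_zero]
    have hp : 0 < (1 + ‖p‖) ^ k := by positivity
    have key : ∀ x ∈ Metric.closedBall p ‖h‖,
        ‖fderiv ℝ Φ x - fderiv ℝ Φ p‖ ≤ C * ‖h‖ / (1 + ‖p‖) ^ k := by
      intro x hx
      rw [mem_closedBall_iff_norm] at hx
      rw [le_div_iff₀ hp]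
      have := hb p x (hx.trans hh)
      simp only [fderivCLM_apply] at this
      calc _ = (1 + ‖p‖) ^ k * ‖fderiv ℝ Φ x - fderiv ℝ Φ p‖ := mul_comm _ _
        _ ≤ _ := this
        _ ≤ _ := by gcongr
    have := (convex_closedBall p ‖h‖).norm_image_sub_le_of_norm_hasFDerivWithin_le' (𝕜 := ℝ)
      (f := Φ) (fun x _ => (Φ.hasFDerivAt x).hasFDerivWithinAt) key
      (Metric.mem_closedBall_self (norm_nonneg _)) (y := p + h)
      (by simp)
    rw [add_sub_cancel_left] at this
    calc _ ≤ (1 + ‖p‖) ^ k * (C * ‖h‖ / (1 + ‖p‖) ^ k * ‖h‖) := by gcongr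
      _ = _ := by field_simp
  | succ n ih =>
    intro F _ _ Φ
    obtain ⟨C, hC, hb⟩ := ih (fderivCLM ℝ W F Φ)
    refine ⟨C, hC, fun h hh p => ?_⟩
    rw [← norm_iteratedFDeriv_fderiv]
    convert hb h hh p using 6 with q
    have hd : DifferentiableAt ℝ (fderiv ℝ Φ) q := (fderivCLM ℝ W F Φ).differentiableAt
    have h1 : HasFDerivAt (fun p => Φ (p + h)) (fderiv ℝ Φ (q + h)) q := by
      simpa [Function.comp_def] using
        (Φ.hasFDerivAt (q + h)).comp q ((hasFDerivAt_id q).add_const h)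
    have h2 : HasFDerivAt (fun p => fderiv ℝ Φ p h) ((fderiv ℝ (fderiv ℝ Φ) q).flip h) q := by
      simpa using hd.hasFDerivAt.clm_apply (hasFDerivAt_const h q)
    rw [((h1.fun_sub (Φ.hasFDerivAt q)).fun_sub h2).fderiv]
    have hs : IsSymmSndFDerivAt ℝ Φ q :=
      (Φ.contDiffAt 2).isSymmSndFDerivAt (by simp)
    ext m
    have he : (⇑((fderivCLM ℝ W F) Φ)) = fderiv ℝ Φ := rfl
    simp [he, hs.eq h m]

theorem schwartz_functional_taylor {W : Type} [NormedAddCommGroup W] [NormedSpace ℝ W]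
    (H : 𝓢(W, ℂ) →L[ℂ] ℂ) (Φ : 𝓢(W, ℂ)) :
    ∃ C : ℝ, ∀ h : W, ‖h‖ ≤ 1 →
      ‖H (compSubConstCLM ℂ (-h) Φ) - H Φ - H (∂_{h} Φ)‖ ≤ C * ‖h‖ ^ 2 := by
  obtain ⟨s, C, -, hC⟩ := Seminorm.bound_of_continuous (schwartz_withSeminorms ℂ W ℂ)
    ((normSeminorm ℂ ℂ).comp H.toLinearMap) (by
      change Continuous fun x => ‖H x‖
      fun_prop)
  choose K hK hb using fun i : ℕ × ℕ => schwartz_taylor i.2 i.1 Φ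
  refine ⟨C * ∑ i ∈ s, K i, fun h hh => ?_⟩
  have h1 := hC (compSubConstCLM ℂ (-h) Φ - Φ - ∂_{h} Φ)
  have h2 : s.sup (schwartzSeminormFamily ℂ W ℂ) (compSubConstCLM ℂ (-h) Φ - Φ - ∂_{h} Φ)
      ≤ (∑ i ∈ s, K i) * ‖h‖ ^ 2 := by
    refine Seminorm.finset_sup_apply_le (by have := Finset.sum_nonneg fun i (_ : i ∈ s) => hK i; positivity) fun i hi => ?_
    refine SchwartzMap.seminorm_le_bound ℂ i.1 i.2 _
      (by have := Finset.sum_nonneg fun i (_ : i ∈ s) => hK i; positivity) fun x => ?_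
    have h3 := hb i h hh x
    have h4 : (⇑(compSubConstCLM ℂ (-h) Φ - Φ - ∂_{h} Φ) : W → ℂ)
        = fun p => Φ (p + h) - Φ p - fderiv ℝ Φ p h := by
      ext p
      simp [lineDerivOp_apply_eq_fderiv]
    rw [h4]
    calc _ ≤ (1 + ‖x‖) ^ i.1 * ‖iteratedFDeriv ℝ i.2
            (fun p => Φ (p + h) - Φ p - fderiv ℝ Φ p h) x‖ := by
          gcongr; linarith [norm_nonneg x]
      _ ≤ K i * ‖h‖ ^ 2 := h3
      _ ≤ _ := by
          gcongr
          exact Finset.single_le_sum (fun i _ => hK i) hi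
  have h5 : ‖H (compSubConstCLM ℂ (-h) Φ) - H Φ - H (∂_{h} Φ)‖
      ≤ C * s.sup (schwartzSeminormFamily ℂ W ℂ) (compSubConstCLM ℂ (-h) Φ - Φ - ∂_{h} Φ) := by
    have : ((normSeminorm ℂ ℂ).comp H.toLinearMap) (compSubConstCLM ℂ (-h) Φ - Φ - ∂_{h} Φ)
      = ‖H (compSubConstCLM ℂ (-h) Φ) - H Φ - H (∂_{h} Φ)‖ := by
        simp
    rw [← this]
    exact h1
  calc _ ≤ _ := h5
    _ ≤ C * ((∑ i ∈ s, K i) * ‖h‖ ^ 2) := by gcongr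
    _ = _ := by ring

section
variable {V₁ V₂ : Type} [NormedAddCommGroup V₁] [InnerProductSpace ℝ V₁]
  [NormedAddCommGroup V₂] [InnerProductSpace ℝ V₂]

/-- The slice `Φ ↦ Φ(x, ·)`. -/
noncomputable def sliceCLM (x : V₁) : 𝓢(WithLp 2 (V₁ × V₂), ℂ) →L[ℂ] 𝓢(V₂, ℂ) :=
  compCLM ℂ (g := fun y : V₂ => WithLp.toLp 2 (x, y))
    (by
      have : (fun y : V₂ => WithLp.toLp 2 (x, y)) = fun y : V₂ =>
          ((WithLp.prodContinuousLinearEquiv 2 ℝ V₁ V₂).symm.toContinuousLinearMap ∘L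
            ContinuousLinearMap.inr ℝ V₁ V₂) y + WithLp.toLp 2 (x, 0) := by
        ext1 y
        exact congrArg (WithLp.toLp 2) (by simp)
      rw [this]
      fun_prop)
    ⟨1, 1, fun y => by
      have := WithLp.norm_snd_le (p := 2) (x := WithLp.toLp 2 (x, y))
      simp only [WithLp.toLp_snd] at this
      linarith [norm_nonneg y]⟩

theorem sliceCLM_apply (x : V₁) (Φ : 𝓢(WithLp 2 (V₁ × V₂), ℂ)) (y : V₂) :
    sliceCLM x Φ y = Φ (WithLp.toLp 2 (x, y)) := rfl

theorem hasFDerivAt_slice [FiniteDimensional ℝ V₁] (G : 𝓢(V₂, ℂ) →L[ℂ] ℂ)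
    (Φ : 𝓢(WithLp 2 (V₁ × V₂), ℂ)) (x : V₁) :
    HasFDerivAt (fun x => G (sliceCLM x Φ))
      (∑ i, (innerSL ℝ (stdOrthonormalBasis ℝ V₁ i)).smulRight
        (G (sliceCLM x (∂_{WithLp.toLp 2 (stdOrthonormalBasis ℝ V₁ i, (0 : V₂))} Φ)))) x := by
  obtain ⟨C, hC⟩ := schwartz_functional_taylor (G ∘L sliceCLM x) Φ
  have hlin : ∀ h : V₁, (∑ i, (innerSL ℝ (stdOrthonormalBasis ℝ V₁ i)).smulRight
        (G (sliceCLM x (∂_{WithLp.toLp 2 (stdOrthonormalBasis ℝ V₁ i, (0 : V₂))} Φ)))) h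
        = G (sliceCLM x (∂_{WithLp.toLp 2 (h, (0 : V₂))} Φ)) := by
    intro h
    have h1 : WithLp.toLp 2 (h, (0 : V₂)) = ∑ i, (inner ℝ (stdOrthonormalBasis ℝ V₁ i) h) •
        WithLp.toLp 2 (stdOrthonormalBasis ℝ V₁ i, (0 : V₂)) := by
      let A := (WithLp.prodContinuousLinearEquiv 2 ℝ V₁ V₂).symm.toContinuousLinearMap ∘L
            ContinuousLinearMap.inl ℝ V₁ V₂
      have : A h = ∑ i, (inner ℝ (stdOrthonormalBasis ℝ V₁ i) h) • A (stdOrthonormalBasis ℝ V₁ i) := by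
        conv_lhs => rw [← (stdOrthonormalBasis ℝ V₁).sum_repr' h]
        simp
      exact this
    have h2 : ∂_{WithLp.toLp 2 (h, (0 : V₂))} Φ = ∑ i, (inner ℝ (stdOrthonormalBasis ℝ V₁ i) h : ℂ) •
        ∂_{WithLp.toLp 2 (stdOrthonormalBasis ℝ V₁ i, (0 : V₂))} Φ := by
      ext p
      simp only [lineDerivOp_apply_eq_fderiv, h1]
      simp [lineDerivOp_apply_eq_fderiv]
    rw [h2]
    simp
  rw [hasFDerivAt_iff_isLittleO_nhds_zero]
  refine Asymptotics.IsBigO.trans_isLittleO (g := fun h : V₁ => ‖h‖ ^ 2) ?_ ?_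
  · refine Asymptotics.IsBigO.of_bound C ?_
    filter_upwards [Metric.closedBall_mem_nhds (0 : V₁) one_pos] with h hh
    rw [hlin]
    have h3 := hC (WithLp.toLp 2 (h, (0 : V₂)))
      (by rw [WithLp.norm_toLp_fst]; simpa using hh)
    rw [WithLp.norm_toLp_fst] at h3
    have h4 : sliceCLM (x + h) Φ
        = sliceCLM x (compSubConstCLM ℂ (-(WithLp.toLp 2 (h, (0 : V₂)))) Φ) := by
      ext y
      simp only [sliceCLM_apply, compSubConstCLM_apply]
      exact congrArg (fun z => Φ (WithLp.toLp 2 z)) (show (x + h, y) = (x, y) - -(h, 0) by simp)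
    rw [h4]
    simpa using h3
  · simpa using (Asymptotics.isLittleO_norm_pow_id (E' := V₁) one_lt_two)

end

theorem schwartz_family {D E : Type} [NormedAddCommGroup D] [NormedSpace ℝ D]
    [NormedAddCommGroup E] [NormedSpace ℝ E] (A : 𝓢(D, ℂ) → E → ℂ)
    {ι : Type} [Fintype ι] (e : ι → (E →L[ℝ] ℝ)) (L : ι → 𝓢(D, ℂ) →L[ℂ] 𝓢(D, ℂ))
    (hd : ∀ Φ x, HasFDerivAt (A Φ) (∑ i, (e i).smulRight (A (L i Φ) x)) x)
    (hb : ∀ k : ℕ, ∃ q : Seminorm ℂ 𝓢(D, ℂ), Continuous q ∧ ∀ Φ x, ‖x‖ ^ k * ‖A Φ x‖ ≤ q Φ) :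
    (∀ Φ, ContDiff ℝ ∞ (A Φ)) ∧ ∀ n : ℕ × ℕ, ∃ (s : Finset (ℕ × ℕ)) (C : ℝ), 0 ≤ C ∧
      ∀ (Φ : 𝓢(D, ℂ)) (x : E), ‖x‖ ^ n.fst * ‖iteratedFDeriv ℝ n.snd (A Φ) x‖
        ≤ C * s.sup (schwartzSeminormFamily ℂ D ℂ) Φ := by
  have hfd : ∀ Φ, fderiv ℝ (A Φ) = fun x => ∑ i,
      (ContinuousLinearMap.smulRightL ℝ E ℂ (e i) ∘ A (L i Φ)) x := by
    intro Φ
    ext1 x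
    rw [(hd Φ x).fderiv]
    rfl
  have hsm : ∀ Φ, ContDiff ℝ ∞ (A Φ) := by
    suffices h : ∀ n : ℕ, ∀ Φ, ContDiff ℝ n (A Φ) from fun Φ => contDiff_infty.2 fun n => h n Φ
    intro n
    induction n with
    | zero =>
      intro Φ
      exact contDiff_zero.2 (continuous_iff_continuousAt.2 fun x => (hd Φ x).continuousAt)
    | succ n ih =>
      intro Φ
      rw [Nat.cast_add, Nat.cast_one, contDiff_succ_iff_fderiv]
      refine ⟨fun x => (hd Φ x).differentiableAt, by simp, ?_⟩
      rw [hfd]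
      exact ContDiff.sum fun i _ => (ContinuousLinearMap.contDiff _).comp (ih _)
  refine ⟨hsm, ?_⟩
  have main : ∀ n k : ℕ, ∃ q : Seminorm ℂ 𝓢(D, ℂ), Continuous q ∧
      ∀ Φ x, ‖x‖ ^ k * ‖iteratedFDeriv ℝ n (A Φ) x‖ ≤ q Φ := by
    intro n k
    induction n with
    | zero => simpa only [norm_iteratedFDeriv_zero] using hb k
    | succ n ih =>
      obtain ⟨q, hq, hqb⟩ := ih
      have hco : ⇑(∑ i, ‖ContinuousLinearMap.smulRightL ℝ E ℂ (e i)‖₊ •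
          q.comp (L i).toLinearMap) = fun Φ => ∑ i,
            ‖ContinuousLinearMap.smulRightL ℝ E ℂ (e i)‖ * q (L i Φ) := by
        ext Φ
        simp [NNReal.smul_def]
      refine ⟨∑ i, ‖ContinuousLinearMap.smulRightL ℝ E ℂ (e i)‖₊ •
        q.comp (L i).toLinearMap, ?_, fun Φ x => ?_⟩
      · rw [hco]
        fun_prop
      · rw [hco, ← norm_iteratedFDeriv_fderiv, hfd, iteratedFDeriv_fun_sum_apply
          (fun i _ => (((ContinuousLinearMap.contDiff _).comp (hsm _)).contDiffAt.of_le
            (mod_cast le_top)))]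
        calc _ ≤ ‖x‖ ^ k * ∑ i, ‖ContinuousLinearMap.smulRightL ℝ E ℂ (e i)‖ *
              ‖iteratedFDeriv ℝ n (A (L i Φ)) x‖ := by
              gcongr
              refine (norm_sum_le _ _).trans (Finset.sum_le_sum fun i _ => ?_)
              exact ContinuousLinearMap.norm_iteratedFDeriv_comp_left _ (hsm _).contDiffAt
                (mod_cast le_top)
          _ = ∑ i, ‖ContinuousLinearMap.smulRightL ℝ E ℂ (e i)‖ *
              (‖x‖ ^ k * ‖iteratedFDeriv ℝ n (A (L i Φ)) x‖) := by
              rw [Finset.mul_sum]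
              exact Finset.sum_congr rfl fun i _ => by ring
          _ ≤ _ := Finset.sum_le_sum fun i _ => by
              gcongr
              exact hqb _ _
  rintro ⟨k, n⟩
  obtain ⟨q, hq, hqb⟩ := main n k
  obtain ⟨s, C, -, hC⟩ := Seminorm.bound_of_continuous (schwartz_withSeminorms ℂ D ℂ) q hq
  exact ⟨s, C, C.2, fun Φ x => (hqb Φ x).trans (hC Φ)⟩

section
variable {V₁ V₂ : Type} [NormedAddCommGroup V₁] [InnerProductSpace ℝ V₁]
  [NormedAddCommGroup V₂] [InnerProductSpace ℝ V₂]

theorem slice_bound (q : Seminorm ℂ 𝓢(V₂, ℂ)) (hq : Continuous q) (k : ℕ) :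
    ∃ r : Seminorm ℂ 𝓢(WithLp 2 (V₁ × V₂), ℂ), Continuous r ∧
      ∀ (Φ : 𝓢(WithLp 2 (V₁ × V₂), ℂ)) (x : V₁), ‖x‖ ^ k * q (sliceCLM x Φ) ≤ r Φ := by
  obtain ⟨s, C, -, hC⟩ := Seminorm.bound_of_continuous (schwartz_withSeminorms ℂ V₂ ℂ) q hq
  have hco : ⇑(C • ∑ i ∈ s, SchwartzMap.seminorm ℂ (E := WithLp 2 (V₁ × V₂)) (F := ℂ) (k + i.1) i.2)
      = fun Φ => C * ∑ i ∈ s, SchwartzMap.seminorm ℂ (k + i.1) i.2 Φ := by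
    ext Φ
    simp [NNReal.smul_def]
  refine ⟨C • ∑ i ∈ s, SchwartzMap.seminorm ℂ (k + i.1) i.2, ?_, fun Φ x => ?_⟩
  · rw [hco]
    have : ∀ i : ℕ × ℕ, Continuous (SchwartzMap.seminorm ℂ (E := WithLp 2 (V₁ × V₂)) (F := ℂ) i.1 i.2) :=
      fun i => (schwartz_withSeminorms ℂ (WithLp 2 (V₁ × V₂)) ℂ).continuous_seminorm i
    exact continuous_const.mul (continuous_finsetSum _ fun i _ => this (k + i.1, i.2))
  · rw [hco]
    have h1 := hC (sliceCLM x Φ)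
    have h1' : q (sliceCLM x Φ) ≤ C * s.sup (schwartzSeminormFamily ℂ V₂ ℂ) (sliceCLM x Φ) := h1
    set R := ∑ i ∈ s, SchwartzMap.seminorm ℂ (k + i.1) i.2 Φ with hR
    have hR0 : 0 ≤ R := Finset.sum_nonneg fun i _ => apply_nonneg _ _
    have h2 : ‖x‖ ^ k * s.sup (schwartzSeminormFamily ℂ V₂ ℂ) (sliceCLM x Φ) ≤ R := by
      rcases eq_or_lt_of_le (show 0 ≤ ‖x‖ ^ k by positivity) with h0 | h0
      · rw [← h0, zero_mul]; exact hR0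
      rw [mul_comm, ← le_div_iff₀ h0]
      refine Seminorm.finset_sup_apply_le (by positivity) fun i hi => ?_
      refine SchwartzMap.seminorm_le_bound ℂ i.1 i.2 _ (by positivity) fun y => ?_
      rw [le_div_iff₀ h0]
      have hn : ‖iteratedFDeriv ℝ i.2 (sliceCLM x Φ) y‖
          ≤ ‖iteratedFDeriv ℝ i.2 Φ (WithLp.toLp 2 (x, y))‖ := by
        let g : V₂ →L[ℝ] WithLp 2 (V₁ × V₂) :=
          (WithLp.prodContinuousLinearEquiv 2 ℝ V₁ V₂).symm.toContinuousLinearMap ∘L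
            ContinuousLinearMap.inr ℝ V₁ V₂
        have hg : ‖g‖ ≤ 1 := g.opNorm_le_bound zero_le_one fun y => by
          rw [one_mul]
          exact (WithLp.norm_toLp_snd 2 V₁ V₂ y).le
        have he : ∀ y, g y + WithLp.toLp 2 (x, (0 : V₂)) = WithLp.toLp 2 (x, y) := fun y =>
          congrArg (WithLp.toLp 2) (show ((0 : V₁), y) + (x, 0) = (x, y) by simp)
        have hf : (⇑(sliceCLM x Φ) : V₂ → ℂ)
            = (fun z => Φ (z + WithLp.toLp 2 (x, (0 : V₂)))) ∘ g := by
          ext y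
          simp only [sliceCLM_apply, Function.comp_apply, he]
        have hsm : ContDiff ℝ ∞ (fun z => Φ (z + WithLp.toLp 2 (x, (0 : V₂)))) :=
          (Φ.smooth ⊤).comp (by fun_prop)
        rw [hf, g.iteratedFDeriv_comp_right hsm y (mod_cast le_top), iteratedFDeriv_comp_add_right,
          he]
        refine (ContinuousMultilinearMap.norm_compContinuousLinearMap_le _ _).trans ?_
        refine mul_le_of_le_one_right (norm_nonneg _) ?_
        exact Finset.prod_le_one (fun _ _ => norm_nonneg _) fun _ _ => hg
      have hx := WithLp.norm_fst_le (p := 2) (x := WithLp.toLp 2 (x, y))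
      have hy := WithLp.norm_snd_le (p := 2) (x := WithLp.toLp 2 (x, y))
      simp only [WithLp.toLp_fst, WithLp.toLp_snd] at hx hy
      calc _ ≤ ‖WithLp.toLp 2 (x, y)‖ ^ i.1 *
            ‖iteratedFDeriv ℝ i.2 Φ (WithLp.toLp 2 (x, y))‖ * ‖WithLp.toLp 2 (x, y)‖ ^ k := by
            gcongr
        _ = ‖WithLp.toLp 2 (x, y)‖ ^ (k + i.1) *
            ‖iteratedFDeriv ℝ i.2 Φ (WithLp.toLp 2 (x, y))‖ := by ring
        _ ≤ SchwartzMap.seminorm ℂ (k + i.1) i.2 Φ := le_seminorm ℂ _ _ _ _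
        _ ≤ R := Finset.single_le_sum
            (f := fun i : ℕ × ℕ => SchwartzMap.seminorm ℂ (k + i.1) i.2 Φ)
            (fun i _ => apply_nonneg _ _) hi
    calc _ ≤ ‖x‖ ^ k * (C * s.sup (schwartzSeminormFamily ℂ V₂ ℂ) (sliceCLM x Φ)) := by gcongr
      _ = C * (‖x‖ ^ k * s.sup (schwartzSeminormFamily ℂ V₂ ℂ) (sliceCLM x Φ)) := by ring
      _ ≤ C * R := by gcongr

theorem partialPairing_aux [FiniteDimensional ℝ V₁] (G : 𝓢(V₂, ℂ) →L[ℂ] ℂ) :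
    (∀ Φ : 𝓢(WithLp 2 (V₁ × V₂), ℂ), ContDiff ℝ ∞ (fun x : V₁ => G (sliceCLM x Φ))) ∧
    ∀ n : ℕ × ℕ, ∃ (s : Finset (ℕ × ℕ)) (C : ℝ), 0 ≤ C ∧
      ∀ (Φ : 𝓢(WithLp 2 (V₁ × V₂), ℂ)) (x : V₁),
        ‖x‖ ^ n.fst * ‖iteratedFDeriv ℝ n.snd (fun x : V₁ => G (sliceCLM x Φ)) x‖
          ≤ C * s.sup (schwartzSeminormFamily ℂ (WithLp 2 (V₁ × V₂)) ℂ) Φ :=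
  schwartz_family (D := WithLp 2 (V₁ × V₂)) (fun Φ (x : V₁) => G (sliceCLM x Φ))
    (fun i => innerSL ℝ (stdOrthonormalBasis ℝ V₁ i))
    (fun i => LineDeriv.lineDerivOpCLM ℂ 𝓢(WithLp 2 (V₁ × V₂), ℂ)
      (WithLp.toLp 2 (stdOrthonormalBasis ℝ V₁ i, (0 : V₂))))
    (fun Φ x => hasFDerivAt_slice G Φ x)
    (fun k => slice_bound ((normSeminorm ℂ ℂ).comp G.toLinearMap) (by
      change Continuous fun x => ‖G x‖
      fun_prop) k)

/-- The partial pairing `Φ ↦ (x ↦ ⟨G, Φ(x, ·)⟩)` with a continuous functional `G`. -/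
noncomputable def partialPairing [FiniteDimensional ℝ V₁] (G : 𝓢(V₂, ℂ) →L[ℂ] ℂ) :
    𝓢(WithLp 2 (V₁ × V₂), ℂ) →L[ℂ] 𝓢(V₁, ℂ) :=
  mkCLM (fun Φ x => G (sliceCLM x Φ)) (fun Φ Ψ x => by simp) (fun a Φ x => by simp)
    (partialPairing_aux G).1 (partialPairing_aux G).2

theorem partialFourier_hasFDerivAt [FiniteDimensional ℝ V₁] [FiniteDimensional ℝ V₂]
    [MeasurableSpace V₂] [BorelSpace V₂]
    (L : Fin (Module.finrank ℝ (WithLp 2 (V₁ × V₂))) →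
      𝓢(WithLp 2 (V₁ × V₂), ℂ) →L[ℂ] 𝓢(WithLp 2 (V₁ × V₂), ℂ))
    (hL : ∀ i Φ p, L i Φ p = fderiv ℝ Φ p
        (WithLp.toLp 2 ((stdOrthonormalBasis ℝ (WithLp 2 (V₁ × V₂)) i).fst, 0))
      + (-(2 * Real.pi * inner ℝ p.snd (stdOrthonormalBasis ℝ (WithLp 2 (V₁ × V₂)) i).snd : ℝ)
        * Complex.I) * Φ p)
    (Φ : 𝓢(WithLp 2 (V₁ × V₂), ℂ)) (p : WithLp 2 (V₁ × V₂)) :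
    HasFDerivAt (fun p : WithLp 2 (V₁ × V₂) => 𝓕 (fun y => Φ (WithLp.toLp 2 (p.fst, y))) p.snd)
      (∑ i, (innerSL ℝ (stdOrthonormalBasis ℝ (WithLp 2 (V₁ × V₂)) i)).smulRight
        (𝓕 (fun y => L i Φ (WithLp.toLp 2 (p.fst, y))) p.snd)) p := by
  set b := stdOrthonormalBasis ℝ (WithLp 2 (V₁ × V₂)) with hb
  have hcont : ∀ (Ψ : 𝓢(WithLp 2 (V₁ × V₂), ℂ)) (p : WithLp 2 (V₁ × V₂)), Continuous
      (fun y : V₂ => Real.fourierChar (-inner ℝ y p.snd) • Ψ (WithLp.toLp 2 (p.fst, y))) := by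
    intro Ψ p
    have := (sliceCLM p.fst Ψ).continuous
    simp only [Circle.smul_def]
    have h2 : Continuous fun y : V₂ => Ψ (WithLp.toLp 2 (p.fst, y)) := this
    fun_prop
  have hdec : ∀ (Ψ : 𝓢(WithLp 2 (V₁ × V₂), ℂ)), ∃ C : ℝ, ∀ (p : WithLp 2 (V₁ × V₂)) (y : V₂),
      ‖Real.fourierChar (-inner ℝ y p.snd) • Ψ (WithLp.toLp 2 (p.fst, y))‖
        ≤ C * (1 + ‖y‖) ^ (-((volume : Measure V₂).integrablePower : ℝ)) := by
    intro Ψ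
    obtain ⟨C, hC, h⟩ := schwartz_decay Ψ (volume : Measure V₂).integrablePower
    refine ⟨C, fun p y => ?_⟩
    rw [Circle.norm_smul, Real.rpow_neg (by positivity), Real.rpow_natCast, ← div_eq_mul_inv,
      le_div_iff₀ (by positivity)]
    have hy := WithLp.norm_snd_le (p := 2) (x := WithLp.toLp 2 (p.fst, y))
    simp only [WithLp.toLp_snd] at hy
    calc _ ≤ ‖Ψ (WithLp.toLp 2 (p.fst, y))‖ *
          (1 + ‖WithLp.toLp 2 (p.fst, y)‖) ^ (volume : Measure V₂).integrablePower := by gcongr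
      _ ≤ C := by rw [mul_comm]; exact h _
  have hint0 := Measure.integrable_pow_neg_integrablePower (volume : Measure V₂)
  have hint : ∀ (Ψ : 𝓢(WithLp 2 (V₁ × V₂), ℂ)) (p : WithLp 2 (V₁ × V₂)), Integrable
      (fun y : V₂ => Real.fourierChar (-inner ℝ y p.snd) • Ψ (WithLp.toLp 2 (p.fst, y))) := by
    intro Ψ p
    obtain ⟨C, hC⟩ := hdec Ψ
    exact (hint0.const_mul C).mono' (hcont Ψ p).aestronglyMeasurable
      (Filter.Eventually.of_forall fun y => hC p y)
  choose K hK using fun i => hdec (L i Φ)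
  have main := hasFDerivAt_integral_of_dominated_of_fderiv_le (𝕜 := ℝ) (μ := (volume : Measure V₂))
    (x₀ := p) (s := Set.univ) (bound := fun y => ∑ i, ‖innerSL ℝ (b i)‖ *
      (K i * (1 + ‖y‖) ^ (-((volume : Measure V₂).integrablePower : ℝ))))
    (F := fun (p : WithLp 2 (V₁ × V₂)) (y : V₂) =>
      Real.fourierChar (-inner ℝ y p.snd) • Φ (WithLp.toLp 2 (p.fst, y)))
    (F' := fun (p : WithLp 2 (V₁ × V₂)) (y : V₂) => ∑ i, (innerSL ℝ (b i)).smulRight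
      (Real.fourierChar (-inner ℝ y p.snd) • L i Φ (WithLp.toLp 2 (p.fst, y))))
    Filter.univ_mem (Filter.Eventually.of_forall fun p => (hcont Φ p).aestronglyMeasurable)
    (hint Φ p)
    (Continuous.aestronglyMeasurable (continuous_finsetSum _ fun i _ =>
      (ContinuousLinearMap.smulRightL ℝ (WithLp 2 (V₁ × V₂)) ℂ
        (innerSL ℝ (b i))).continuous.comp (hcont (L i Φ) p)))
    (Filter.Eventually.of_forall fun y p _ => (norm_sum_le _ _).trans
      (Finset.sum_le_sum fun i _ => by
        rw [ContinuousLinearMap.norm_smulRight_apply]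
        gcongr
        exact hK i p y))
    (integrable_finsetSum _ fun i _ => (hint0.const_mul _).const_mul _)
    (Filter.Eventually.of_forall fun y p _ => ?_)
  · have h1 : (∫ y : V₂, ∑ i, (innerSL ℝ (b i)).smulRight
        (Real.fourierChar (-inner ℝ y p.snd) • L i Φ (WithLp.toLp 2 (p.fst, y))))
        = ∑ i, (innerSL ℝ (b i)).smulRight
          (𝓕 (fun y => L i Φ (WithLp.toLp 2 (p.fst, y))) p.snd) := by
      rw [integral_finsetSum]
      · refine Finset.sum_congr rfl fun i _ => ?_
        rw [Real.fourier_eq]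
        exact (ContinuousLinearMap.smulRightL ℝ (WithLp 2 (V₁ × V₂)) ℂ
          (innerSL ℝ (b i))).integral_comp_comm (hint (L i Φ) p)
      · intro i _
        exact (ContinuousLinearMap.smulRightL ℝ (WithLp 2 (V₁ × V₂)) ℂ
          (innerSL ℝ (b i))).integrable_comp (hint (L i Φ) p)
    rw [← h1]
    exact main
  · let A : WithLp 2 (V₁ × V₂) →L[ℝ] WithLp 2 (V₁ × V₂) :=
      (WithLp.prodContinuousLinearEquiv 2 ℝ V₁ V₂).symm.toContinuousLinearMap ∘L
        ContinuousLinearMap.inl ℝ V₁ V₂ ∘L WithLp.fstL 2 ℝ V₁ V₂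
    have hA : ∀ m, A m = WithLp.toLp 2 (m.fst, (0 : V₂)) := fun m => rfl
    let z := WithLp.toLp 2 (p.fst, y)
    have d1 : HasFDerivAt (fun p : WithLp 2 (V₁ × V₂) => Φ (WithLp.toLp 2 (p.fst, y)))
        ((fderiv ℝ Φ z).comp A) p := by
      have he : ∀ p : WithLp 2 (V₁ × V₂), WithLp.toLp 2 (p.fst, y) = A p + WithLp.toLp 2 (0, y) :=
        fun p => congrArg (WithLp.toLp 2) (show (p.fst, y) = (p.fst, (0 : V₂)) + (0, y) by simp)
      have h1 : HasFDerivAt (fun p : WithLp 2 (V₁ × V₂) => WithLp.toLp 2 (p.fst, y)) A p := by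
        simp only [he]
        exact A.hasFDerivAt.add_const _
      exact (Φ.hasFDerivAt z).comp p h1
    have d2 : HasFDerivAt (fun p : WithLp 2 (V₁ × V₂) =>
        ((Real.fourierChar (-inner ℝ y p.snd) : Circle) : ℂ))
        (((innerSL ℝ y).comp (WithLp.sndL 2 ℝ V₁ V₂)).smulRight
          (-(2 * Real.pi * Complex.I) * ((Real.fourierChar (-inner ℝ y p.snd) : Circle) : ℂ))) p := by
      have h1 : HasFDerivAt (fun p : WithLp 2 (V₁ × V₂) => -inner ℝ y p.snd)
          (-((innerSL ℝ y).comp (WithLp.sndL 2 ℝ V₁ V₂))) p :=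
        ((innerSL ℝ y).comp (WithLp.sndL 2 ℝ V₁ V₂)).hasFDerivAt.neg
      have h2 := (Real.hasDerivAt_fourierChar (-inner ℝ y p.snd)).hasFDerivAt
      have h3 := HasFDerivAt.comp (f := fun p : WithLp 2 (V₁ × V₂) => -inner ℝ y p.snd) p h2 h1
      refine h3.congr_fderiv (ContinuousLinearMap.ext fun m => ?_)
      simp
    have d3 := d2.mul d1
    simp only [Circle.smul_def, smul_eq_mul]
    refine HasFDerivAt.congr_fderiv (𝕜 := ℝ) (F := ℂ) d3 (ContinuousLinearMap.ext fun m => ?_)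
    symm
    conv_rhs => rw [← b.sum_repr' m, map_sum]
    simp only [_root_.sum_apply]
    refine Finset.sum_congr rfl fun i _ => ?_
    rw [ContinuousLinearMap.map_smul, ContinuousLinearMap.smulRight_apply, innerSL_apply_apply, hL]
    congr 1
    simp [hA, z]
    ring

theorem partialFourier_aux [FiniteDimensional ℝ V₁] [FiniteDimensional ℝ V₂]
    [MeasurableSpace V₂] [BorelSpace V₂] :
    (∀ Φ : 𝓢(WithLp 2 (V₁ × V₂), ℂ), ContDiff ℝ ∞
      (fun p : WithLp 2 (V₁ × V₂) => 𝓕 (fun y => Φ (WithLp.toLp 2 (p.fst, y))) p.snd)) ∧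
    ∀ n : ℕ × ℕ, ∃ (s : Finset (ℕ × ℕ)) (C : ℝ), 0 ≤ C ∧
      ∀ (Φ : 𝓢(WithLp 2 (V₁ × V₂), ℂ)) (p : WithLp 2 (V₁ × V₂)),
        ‖p‖ ^ n.fst * ‖iteratedFDeriv ℝ n.snd (fun p : WithLp 2 (V₁ × V₂) =>
            𝓕 (fun y => Φ (WithLp.toLp 2 (p.fst, y))) p.snd) p‖
          ≤ C * s.sup (schwartzSeminormFamily ℂ (WithLp 2 (V₁ × V₂)) ℂ) Φ := by
  let b := stdOrthonormalBasis ℝ (WithLp 2 (V₁ × V₂))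
  let mult : Fin (Module.finrank ℝ (WithLp 2 (V₁ × V₂))) → WithLp 2 (V₁ × V₂) → ℂ := fun i p =>
    -((2 * Real.pi * inner ℝ p.snd (b i).snd : ℝ) : ℂ) * Complex.I
  have hmult : ∀ i, (mult i).HasTemperateGrowth := by
    intro i
    let A : WithLp 2 (V₁ × V₂) →L[ℝ] ℂ :=
      ((innerSL ℝ (b i).snd).comp (WithLp.sndL 2 ℝ V₁ V₂)).smulRight
        (-(2 * Real.pi * Complex.I))
    have : mult i = A := by
      ext p
      simp only [mult, A, ContinuousLinearMap.smulRight_apply, ContinuousLinearMap.comp_apply,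
        innerSL_apply_apply, real_inner_comm (b i).snd]
      simp
      ring
    rw [this]
    exact A.hasTemperateGrowth
  refine schwartz_family (D := WithLp 2 (V₁ × V₂)) _ (fun i => innerSL ℝ (b i))
    (fun i => LineDeriv.lineDerivOpCLM ℂ 𝓢(WithLp 2 (V₁ × V₂), ℂ) (WithLp.toLp 2 ((b i).fst, (0 : V₂)))
      + smulLeftCLM ℂ (mult i))
    (partialFourier_hasFDerivAt _ fun i Φ p => ?_) fun k => ?_
  · change (∂_{WithLp.toLp 2 ((b i).fst, (0 : V₂))} Φ) p + smulLeftCLM ℂ (mult i) Φ p = _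
    rw [smulLeftCLM_apply_apply (hmult i)]
    rfl
  · let F := FourierTransform.fourierCLM ℂ 𝓢(V₂, ℂ)
    have hc : ∀ i : ℕ × ℕ, Continuous ((SchwartzMap.seminorm ℂ i.1 i.2).comp F.toLinearMap) := by
      intro i
      exact ((schwartz_withSeminorms ℂ V₂ ℂ).continuous_seminorm i).comp F.continuous
    obtain ⟨r₁, hr₁, h₁⟩ := slice_bound (V₁ := V₁) _ (hc (0, 0)) k
    obtain ⟨r₂, hr₂, h₂⟩ := slice_bound (V₁ := V₁) _ (hc (k, 0)) 0
    refine ⟨(2 ^ (k - 1) : NNReal) • (r₁ + r₂), ?_, fun Φ p => ?_⟩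
    · change Continuous fun Φ => (2 ^ (k - 1) : NNReal) • (r₁ Φ + r₂ Φ)
      fun_prop
    · change _ ≤ (2 ^ (k - 1) : ℝ) * (r₁ Φ + r₂ Φ)
      have e : 𝓕 (fun y => Φ (WithLp.toLp 2 (p.fst, y))) p.snd
          = F (sliceCLM p.fst Φ) p.snd := rfl
      rw [e]
      have n0 := norm_le_seminorm ℂ (F (sliceCLM p.fst Φ)) p.snd
      have nk := norm_pow_mul_le_seminorm ℂ (F (sliceCLM p.fst Φ)) k p.snd
      have g1 := h₁ Φ p.fst
      have g2 := h₂ Φ p.fst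
      rw [pow_zero, one_mul] at g2
      have hp : ‖p‖ ≤ ‖p.fst‖ + ‖p.snd‖ := by
        have : p = WithLp.toLp 2 (p.fst, (0 : V₂)) + WithLp.toLp 2 ((0 : V₁), p.snd) :=
          congrArg (WithLp.toLp 2) (show (p.fst, p.snd) = (p.fst, 0) + (0, p.snd) by simp)
        calc ‖p‖ = _ := congrArg _ this
          _ ≤ _ := norm_add_le _ _
          _ = _ := by rw [WithLp.norm_toLp_fst, WithLp.norm_toLp_snd]
      calc _ ≤ (‖p.fst‖ + ‖p.snd‖) ^ k * ‖F (sliceCLM p.fst Φ) p.snd‖ := by gcongr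
        _ ≤ (2 ^ (k - 1) * (‖p.fst‖ ^ k + ‖p.snd‖ ^ k)) * ‖F (sliceCLM p.fst Φ) p.snd‖ := by
            gcongr
            exact add_pow_le (norm_nonneg _) (norm_nonneg _) k
        _ = 2 ^ (k - 1) * (‖p.fst‖ ^ k * ‖F (sliceCLM p.fst Φ) p.snd‖
              + ‖p.snd‖ ^ k * ‖F (sliceCLM p.fst Φ) p.snd‖) := by ring
        _ ≤ _ := by
            gcongr
            · exact le_trans (by gcongr; exact n0) g1
            · exact nk.trans g2

/-- The partial Fourier transform in the second variable,
`(x, ξ) ↦ ∫ e^{-2πi y·ξ} Φ(x, y) dy`. -/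
noncomputable def partialFourier [FiniteDimensional ℝ V₁] [FiniteDimensional ℝ V₂]
    [MeasurableSpace V₂] [BorelSpace V₂] :
    𝓢(WithLp 2 (V₁ × V₂), ℂ) →L[ℂ] 𝓢(WithLp 2 (V₁ × V₂), ℂ) :=
  mkCLM (fun Φ p => 𝓕 (fun y => Φ (WithLp.toLp 2 (p.fst, y))) p.snd)
    (fun Φ Ψ p => congrFun (congrArg DFunLike.coe
      (map_add (FourierTransform.fourierCLM ℂ 𝓢(V₂, ℂ) ∘L sliceCLM p.fst) Φ Ψ)) p.snd)
    (fun a Φ p => congrFun (congrArg DFunLike.coe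
      (map_smul (FourierTransform.fourierCLM ℂ 𝓢(V₂, ℂ) ∘L sliceCLM p.fst) a Φ)) p.snd)
    partialFourier_aux.1 partialFourier_aux.2
end

section
variable {V₁ V₂ : Type} [NormedAddCommGroup V₁] [InnerProductSpace ℝ V₁]
  [NormedAddCommGroup V₂] [InnerProductSpace ℝ V₂]

theorem tensorS_aux (f : 𝓢(V₁, ℂ)) (g : 𝓢(V₂, ℂ)) :
    ContDiff ℝ ∞ (fun p : WithLp 2 (V₁ × V₂) => f p.fst * g p.snd) ∧
    ∀ k n : ℕ, ∃ C : ℝ, ∀ p : WithLp 2 (V₁ × V₂),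
      ‖p‖ ^ k * ‖iteratedFDeriv ℝ n (fun p : WithLp 2 (V₁ × V₂) => f p.fst * g p.snd) p‖ ≤ C := by
  have hf : ContDiff ℝ ∞ (f ∘ WithLp.fstL 2 ℝ V₁ V₂) :=
    (f.smooth ⊤).comp (ContinuousLinearMap.contDiff _)
  have hg : ContDiff ℝ ∞ (g ∘ WithLp.sndL 2 ℝ V₁ V₂) :=
    (g.smooth ⊤).comp (ContinuousLinearMap.contDiff _)
  refine ⟨hf.mul hg, fun k n => ?_⟩
  have hf1 : ‖WithLp.fstL 2 ℝ V₁ V₂‖ ≤ 1 := ContinuousLinearMap.opNorm_le_bound _ zero_le_one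
    fun p => by rw [one_mul]; exact WithLp.norm_fst_le (p := 2) (x := p)
  have hg1 : ‖WithLp.sndL 2 ℝ V₁ V₂‖ ≤ 1 := ContinuousLinearMap.opNorm_le_bound _ zero_le_one
    fun p => by rw [one_mul]; exact WithLp.norm_snd_le (p := 2) (x := p)
  have bf : ∀ i, ∃ C : ℝ, 0 ≤ C ∧ ∀ p : WithLp 2 (V₁ × V₂),
      (1 + ‖p.fst‖) ^ k * ‖iteratedFDeriv ℝ i (f ∘ WithLp.fstL 2 ℝ V₁ V₂) p‖ ≤ C := by
    intro i
    refine ⟨2 ^ k * ((Finset.Iic (k, i)).sup fun m => SchwartzMap.seminorm ℝ m.1 m.2) f,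
      by positivity, fun p => ?_⟩
    refine le_trans ?_
      (one_add_le_sup_seminorm_apply (𝕜 := ℝ) (m := (k, i)) le_rfl le_rfl f p.fst)
    gcongr
    rw [ContinuousLinearMap.iteratedFDeriv_comp_right _ (f.smooth ⊤) p (mod_cast le_top)]
    refine (ContinuousMultilinearMap.norm_compContinuousLinearMap_le _ _).trans ?_
    exact mul_le_of_le_one_right (norm_nonneg _)
      (Finset.prod_le_one (fun _ _ => norm_nonneg _) fun _ _ => hf1)
  have bg : ∀ i, ∃ C : ℝ, 0 ≤ C ∧ ∀ p : WithLp 2 (V₁ × V₂),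
      (1 + ‖p.snd‖) ^ k * ‖iteratedFDeriv ℝ i (g ∘ WithLp.sndL 2 ℝ V₁ V₂) p‖ ≤ C := by
    intro i
    refine ⟨2 ^ k * ((Finset.Iic (k, i)).sup fun m => SchwartzMap.seminorm ℝ m.1 m.2) g,
      by positivity, fun p => ?_⟩
    refine le_trans ?_
      (one_add_le_sup_seminorm_apply (𝕜 := ℝ) (m := (k, i)) le_rfl le_rfl g p.snd)
    gcongr
    rw [ContinuousLinearMap.iteratedFDeriv_comp_right _ (g.smooth ⊤) p (mod_cast le_top)]
    refine (ContinuousMultilinearMap.norm_compContinuousLinearMap_le _ _).trans ?_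
    exact mul_le_of_le_one_right (norm_nonneg _)
      (Finset.prod_le_one (fun _ _ => norm_nonneg _) fun _ _ => hg1)
  choose A hA0 hA using bf
  choose B hB0 hB using bg
  refine ⟨∑ i ∈ Finset.range (n + 1), (n.choose i : ℝ) * (A i * B (n - i)), fun p => ?_⟩
  have hp : ‖p‖ ≤ (1 + ‖p.fst‖) * (1 + ‖p.snd‖) := by
    have : p = WithLp.toLp 2 (p.fst, (0 : V₂)) + WithLp.toLp 2 ((0 : V₁), p.snd) :=
      congrArg (WithLp.toLp 2) (show (p.fst, p.snd) = (p.fst, 0) + (0, p.snd) by simp)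
    calc ‖p‖ = _ := congrArg _ this
      _ ≤ _ := norm_add_le _ _
      _ = ‖p.fst‖ + ‖p.snd‖ := by rw [WithLp.norm_toLp_fst, WithLp.norm_toLp_snd]
      _ ≤ _ := by nlinarith [norm_nonneg p.fst, norm_nonneg p.snd]
  have hm := norm_iteratedFDeriv_mul_le hf hg p (n := n) (mod_cast le_top)
  calc _ ≤ ((1 + ‖p.fst‖) * (1 + ‖p.snd‖)) ^ k * ∑ i ∈ Finset.range (n + 1), (n.choose i : ℝ) *
        ‖iteratedFDeriv ℝ i (f ∘ WithLp.fstL 2 ℝ V₁ V₂) p‖ *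
        ‖iteratedFDeriv ℝ (n - i) (g ∘ WithLp.sndL 2 ℝ V₁ V₂) p‖ := by
        gcongr
        exact hm
    _ = ∑ i ∈ Finset.range (n + 1), (n.choose i : ℝ) *
        (((1 + ‖p.fst‖) ^ k * ‖iteratedFDeriv ℝ i (f ∘ WithLp.fstL 2 ℝ V₁ V₂) p‖) *
        ((1 + ‖p.snd‖) ^ k * ‖iteratedFDeriv ℝ (n - i) (g ∘ WithLp.sndL 2 ℝ V₁ V₂) p‖)) := by
        rw [mul_pow, Finset.mul_sum]
        exact Finset.sum_congr rfl fun i _ => by ring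
    _ ≤ _ := Finset.sum_le_sum fun i _ => by
        gcongr
        · exact hA0 i
        · exact hA i p
        · exact hB (n - i) p

/-- The tensor product `(f ⊗ g)(x, y) = f(x) g(y)` of two Schwartz functions. -/
noncomputable def tensorS (f : 𝓢(V₁, ℂ)) (g : 𝓢(V₂, ℂ)) : 𝓢(WithLp 2 (V₁ × V₂), ℂ) where
  toFun p := f p.fst * g p.snd
  smooth' := (tensorS_aux f g).1
  decay' := (tensorS_aux f g).2

/-- A tempered distribution as a continuous linear functional. -/
noncomputable def toDual (G : 𝓢'(V₂, ℂ)) : 𝓢(V₂, ℂ) →L[ℂ] ℂ where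
  toFun := G
  map_add' := map_add G
  map_smul' := map_smul G
  cont := map_continuous G

/-- The tensor product `F ⊗ G` of two tempered distributions,
`⟨F ⊗ G, Φ⟩ = ⟨F, x ↦ ⟨G, Φ(x, ·)⟩⟩` (linear brackets). -/
noncomputable def tensorD [FiniteDimensional ℝ V₁] (F : 𝓢'(V₁, ℂ)) (G : 𝓢'(V₂, ℂ)) :
    𝓢'(WithLp 2 (V₁ × V₂), ℂ) :=
  PointwiseConvergenceCLM.precomp ℂ (partialPairing (toDual G)) F

theorem tensorD_tensorS [FiniteDimensional ℝ V₁] (F : 𝓢'(V₁, ℂ)) (G : 𝓢'(V₂, ℂ))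
    (f : 𝓢(V₁, ℂ)) (g : 𝓢(V₂, ℂ)) : tensorD F G (tensorS f g) = F f * G g := by
  have h : ∀ x, sliceCLM x (tensorS f g) = f x • g := fun x => by
    ext y
    rfl
  have h2 : partialPairing (toDual G) (tensorS f g) = G g • f := by
    ext x
    change G (sliceCLM x (tensorS f g)) = G g * f x
    rw [h, map_smul, smul_eq_mul, mul_comm]
  change F (partialPairing (toDual G) (tensorS f g)) = _
  rw [h2, map_smul, smul_eq_mul, mul_comm]

end

section
variable {V : Type} [NormedAddCommGroup V] [InnerProductSpace ℝ V]

/-- The complex conjugate of a Schwartz function. -/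
noncomputable def conjS (f : 𝓢(V, ℂ)) : 𝓢(V, ℂ) :=
  postcompCLM (𝕜 := ℝ) (Complex.conjCLE : ℂ →L[ℝ] ℂ) f

theorem conjS_apply (f : 𝓢(V, ℂ)) (x : V) : conjS f x = (starRingEnd ℂ) (f x) := rfl

theorem continuous_conjS : Continuous (conjS : 𝓢(V, ℂ) → 𝓢(V, ℂ)) :=
  (postcompCLM (𝕜 := ℝ) (E := V) (Complex.conjCLE : ℂ →L[ℝ] ℂ)).continuous

/-- The complex conjugate of a tempered distribution, `F̄(φ) = conj (F (conj φ))`. -/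
noncomputable def conjD (F : 𝓢'(V, ℂ)) : 𝓢'(V, ℂ) :=
  ContinuousLinearMap.toPointwiseConvergenceCLM ℂ (RingHom.id ℂ) 𝓢(V, ℂ) ℂ
    { toFun := fun φ => (starRingEnd ℂ) (F (conjS φ))
      map_add' := fun φ ψ => by
        have : conjS (φ + ψ) = conjS φ + conjS ψ := by ext x; simp [conjS_apply]
        rw [this, map_add, map_add]
      map_smul' := fun a φ => by
        have : conjS (a • φ) = (starRingEnd ℂ) a • conjS φ := by ext x; simp [conjS_apply]
        rw [this, map_smul]
        simp
      cont := Complex.continuous_conj.comp ((map_continuous F).comp continuous_conjS) }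

/-- The bracket `⟨F, φ⟩` extending the inner product `∫ F(x) conj(φ(x)) dx`; it is conjugate-linear
in the second argument. -/
noncomputable def bracket (F : 𝓢'(V, ℂ)) (φ : 𝓢(V, ℂ)) : ℂ := F (conjS φ)

/-- The linear change of variables `F ∘ A` of a tempered distribution, i.e.
`(F ∘ A)(φ) = |det A|⁻¹ F(φ ∘ A⁻¹)`. -/
noncomputable def compD (A : V ≃L[ℝ] V) (F : 𝓢'(V, ℂ)) : 𝓢'(V, ℂ) :=
  ((|(A : V →L[ℝ] V).det|⁻¹ : ℝ) : ℂ) •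
    PointwiseConvergenceCLM.precomp ℂ (compCLMOfContinuousLinearEquiv ℂ A.symm) F

/-- The map `(x, t) ↦ (x + t / 2, x - t / 2)`. -/
noncomputable def wignerEquiv (V : Type) [NormedAddCommGroup V] [InnerProductSpace ℝ V] :
    WithLp 2 (V × V) ≃L[ℝ] WithLp 2 (V × V) :=
  ((WithLp.prodContinuousLinearEquiv 2 ℝ V V).trans
    { toFun := fun p => (p.1 + (1 / 2 : ℝ) • p.2, p.1 - (1 / 2 : ℝ) • p.2)
      invFun := fun q => ((1 / 2 : ℝ) • (q.1 + q.2), q.1 - q.2)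
      map_add' := fun p q => by ext <;> simp <;> abel
      map_smul' := fun c p => by ext <;> simp [smul_sub, smul_comm c]
      left_inv := fun p => by ext <;> simp <;> module
      right_inv := fun p => by ext <;> simp <;> module
      continuous_toFun := by fun_prop
      continuous_invFun := by fun_prop }).trans
    (WithLp.prodContinuousLinearEquiv 2 ℝ V V).symm

theorem wignerEquiv_apply (x t : V) : wignerEquiv V (WithLp.toLp 2 (x, t)) =
    WithLp.toLp 2 (x + (1 / 2 : ℝ) • t, x - (1 / 2 : ℝ) • t) := rfl

variable [FiniteDimensional ℝ V] [MeasurableSpace V] [BorelSpace V]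

/-- The cross-Wigner distribution of two Schwartz functions, a Schwartz function on phase space. -/
noncomputable def crossWigner (f g : 𝓢(V, ℂ)) : 𝓢(WithLp 2 (V × V), ℂ) :=
  partialFourier (compCLMOfContinuousLinearEquiv ℂ (wignerEquiv V) (tensorS f (conjS g)))

/-- `W(f,g)(x,ξ) = ∫ f(x + t/2) conj(g(x - t/2)) e^{-2πi t·ξ} dt`. -/
theorem crossWigner_apply (f g : 𝓢(V, ℂ)) (x ξ : V) :
    crossWigner f g (WithLp.toLp 2 (x, ξ)) =
      ∫ t : V, f (x + (1 / 2 : ℝ) • t) * (starRingEnd ℂ) (g (x - (1 / 2 : ℝ) • t)) *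
        Complex.exp (-(2 * Real.pi * Complex.I * (inner ℝ t ξ : ℝ))) := by
  change 𝓕 (fun t => f (x + (1 / 2 : ℝ) • t) * (starRingEnd ℂ) (g (x - (1 / 2 : ℝ) • t))) ξ = _
  rw [Real.fourier_eq]
  congr 1
  ext t
  rw [Circle.smul_def, Real.fourierChar_apply, smul_eq_mul, mul_comm]
  congr 2
  push_cast
  ring

/-- The partial Fourier transform in the second variable of a tempered distribution. -/
noncomputable def partialFourierD (F : 𝓢'(WithLp 2 (V × V), ℂ)) : 𝓢'(WithLp 2 (V × V), ℂ) :=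
  PointwiseConvergenceCLM.precomp ℂ partialFourier F

/-- The cross-Wigner distribution of two tempered distributions:
the partial Fourier transform `t → ξ` of `(F ⊗ Ḡ)(x + t/2, x - t/2)`. -/
noncomputable def crossWignerD (F G : 𝓢'(V, ℂ)) : 𝓢'(WithLp 2 (V × V), ℂ) :=
  partialFourierD (compD (wignerEquiv V) (tensorD F (conjD G)))

/-- The map `((x, ξ), (y, η)) ↦ ((x, y), (ξ, -η))`. -/
noncomputable def permEquiv (V : Type) [NormedAddCommGroup V] [InnerProductSpace ℝ V] :
    WithLp 2 (WithLp 2 (V × V) × WithLp 2 (V × V)) ≃L[ℝ]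
      WithLp 2 (WithLp 2 (V × V) × WithLp 2 (V × V)) where
  toFun p := WithLp.toLp 2
    (WithLp.toLp 2 (p.fst.fst, p.snd.fst), WithLp.toLp 2 (p.fst.snd, -p.snd.snd))
  invFun p := WithLp.toLp 2
    (WithLp.toLp 2 (p.fst.fst, p.snd.fst), WithLp.toLp 2 (p.fst.snd, -p.snd.snd))
  map_add' p q := by
    simp only [WithLp.add_fst, WithLp.add_snd, neg_add]
    rfl
  map_smul' c p := by
    simp only [WithLp.smul_fst, WithLp.smul_snd, ← smul_neg]
    rfl
  left_inv p := by
    simp only [WithLp.toLp_fst, WithLp.toLp_snd, neg_neg]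
    rfl
  right_inv p := by
    simp only [WithLp.toLp_fst, WithLp.toLp_snd, neg_neg]
    rfl
  continuous_toFun := by fun_prop
  continuous_invFun := by fun_prop

/-- `k` is the Schwartz kernel of `T`: `⟨T f, g⟩ = ⟨k, g ⊗ f̄⟩`. -/
def IsSchwartzKernel (T : 𝓢(V, ℂ) →L[ℂ] 𝓢'(V, ℂ)) (k : 𝓢'(WithLp 2 (V × V), ℂ)) : Prop :=
  ∀ f g : 𝓢(V, ℂ), bracket (T f) g = bracket k (tensorS g (conjS f))

/-- `k` is a Wigner kernel of `T`: `⟨W(Tf, Tg), W(u, v)⟩ = ⟨k, W(u, v) ⊗ conj W(f, g)⟩`. -/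
def IsWignerKernel (T : 𝓢(V, ℂ) →L[ℂ] 𝓢'(V, ℂ))
    (k : 𝓢'(WithLp 2 (WithLp 2 (V × V) × WithLp 2 (V × V)), ℂ)) : Prop :=
  ∀ f g u v : 𝓢(V, ℂ), bracket (crossWignerD (T f) (T g)) (crossWigner u v) =
    bracket k (tensorS (crossWigner u v) (conjS (crossWigner f g)))

/-- The tempered distribution `F` is given by a square-integrable function. -/
def MemL2 (F : 𝓢'(V, ℂ)) : Prop :=
  ∃ h : Lp ℂ 2 (volume : Measure V), Lp.toTemperedDistribution h = F

/-- The tempered distribution `F` is given by a Schwartz function. -/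
def MemSchwartz (F : 𝓢'(V, ℂ)) : Prop :=
  ∃ h : 𝓢(V, ℂ), SchwartzMap.toTemperedDistributionCLM V ℂ volume h = F

end

end WignerKernel

open WignerKernel
open scoped SchwartzMap

namespace WignerKernel

open MeasureTheory SchwartzMap Filter Topology
open scoped FourierTransform LineDeriv ContDiff

/-! The Wigner transform of a function of two variables, `wignerTransform`, is a volume-preserving
linear substitution followed by a partial Fourier transform. It is therefore a bijection of the
Schwartz space that preserves the `L²` inner product, and the same holds for `permWigner`, which is
`𝔗_p` after the transform on the doubled space. Call this last operator `U`.

Two identities carry the theorem. By duality, `⟨𝔗_p W F, U H⟩ = ⟨F ⊗ F̄, H⟩` for every tempered `F`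
(`bracket_compD_permEquiv`). By Fubini, `U` sends `(u ⊗ f̄) ⊗ conj (v ⊗ ḡ)` to `W(u,v) ⊗ conj
W(f,g)` (`permWigner_tensorS`). With `F = k_T`, the pairing of `𝔗_p W k_T` with `W(u,v) ⊗ conj
W(f,g)` equals `⟨Tf,u⟩ · conj ⟨Tg,v⟩`, and by the distributional Moyal identity this is `⟨W(Tf,Tg),
W(u,v)⟩`. So `𝔗_p W k_T` is a Wigner kernel. It is the only one, because `U` is onto and a tempered
distribution is determined by its values on pure tensors. On the diagonal the pairing is
`|⟨Tg,f⟩|²`, whence positivity.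

Since `U` is an inner-product-preserving bijection, `k` is in `L²` or in the Schwartz class exactly
when `k_T ⊗ conj k_T` is. Freezing the second variable against a test function on which `conj k_T`
does not vanish shows that this happens exactly when `k_T` is in the class.

The remaining input is the Schwartz kernel theorem, obtained from atomic decompositions. Every
Schwartz function is an unconditional sum `∑ cᵢ(f) eᵢ`, with rapidly decreasing coefficients and
atoms of polynomial growth. On the line these are Gabor expansions, produced by a smooth partition
of unity and Poisson summation; tensor products give all dimensions. A Baire argument bounds `T f g`
jointly in `f` and `g`, so the matrix of `T` in the atoms grows polynomially and defines a
functional on the product space. -/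

/-! ### Series, increasing norms, completeness and Banach–Steinhaus on the Schwartz space -/

/-- Termwise differentiation makes the pointwise sum smooth, and in each seminorm the error of a
partial sum is at most the tail of the summed seminorms. Completeness of the Schwartz space is not
assumed here; it is deduced from this lemma. -/
theorem schwartz_exists_hasSum {E ι : Type*} [NormedAddCommGroup E] [NormedSpace ℝ E]
    (f : ι → 𝓢(E, ℂ)) (hf : ∀ k n, Summable fun i => SchwartzMap.seminorm ℂ k n (f i)) :
    ∃ g : 𝓢(E, ℂ), (∀ x, g x = ∑' i, f i x) ∧ HasSum f g := by
  have hsm : ∀ i, ContDiff ℝ ∞ (f i) := fun i => (f i).smooth ⊤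
  have hb : ∀ (k : ℕ) (i : ι) (x : E), ((k : ℕ∞) ≤ (⊤ : ℕ∞)) →
      ‖iteratedFDeriv ℝ k (f i) x‖ ≤ SchwartzMap.seminorm ℂ 0 k (f i) :=
    fun k i x _ => norm_iteratedFDeriv_le_seminorm ℂ (f i) k x
  have hder : ∀ (n : ℕ) (x : E), iteratedFDeriv ℝ n (fun y => ∑' i, f i y) x
      = ∑' i, iteratedFDeriv ℝ n (f i) x := fun n x =>
    iteratedFDeriv_tsum_apply hsm (fun k _ => hf 0 k) hb (mod_cast le_top) x
  have hsd : ∀ (n : ℕ) (x : E), Summable fun i => iteratedFDeriv ℝ n (f i) x := fun n x =>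
    Summable.of_norm_bounded (hf 0 n) fun i => hb n i x (mod_cast le_top)
  have hle : ∀ (k n : ℕ) (x : E) (i : ι),
      ‖x‖ ^ k * ‖iteratedFDeriv ℝ n (f i) x‖ ≤ SchwartzMap.seminorm ℂ k n (f i) :=
    fun k n x i => le_seminorm ℂ k n (f i) x
  have htail : ∀ (s : Set ι) (k n : ℕ) (x : E),
      ‖x‖ ^ k * ‖∑' i : s, iteratedFDeriv ℝ n (f i) x‖
        ≤ ∑' i : s, SchwartzMap.seminorm ℂ k n (f i) := by
    intro s k n x
    have h1 : Summable fun i : s => ‖x‖ ^ k * ‖iteratedFDeriv ℝ n (f i) x‖ :=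
      Summable.of_nonneg_of_le (fun i => by positivity) (fun i => hle k n x i)
        ((hf k n).subtype s)
    have h0 : Summable fun i : s => ‖iteratedFDeriv ℝ n (f i) x‖ :=
      Summable.of_nonneg_of_le (fun i => by positivity) (fun i => hb n i x (mod_cast le_top))
        ((hf 0 n).subtype s)
    calc _ ≤ ‖x‖ ^ k * ∑' i : s, ‖iteratedFDeriv ℝ n (f i) x‖ := by
          gcongr
          exact norm_tsum_le_tsum_norm h0
      _ = ∑' i : s, ‖x‖ ^ k * ‖iteratedFDeriv ℝ n (f i) x‖ := by rw [tsum_mul_left]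
      _ ≤ _ := h1.tsum_le_tsum (fun i => hle k n x i) ((hf k n).subtype s)
  let g : 𝓢(E, ℂ) :=
    { toFun := fun x => ∑' i, f i x
      smooth' := contDiff_tsum hsm (fun k _ => hf 0 k) hb
      decay' := fun k n => ⟨∑' i : (Set.univ : Set ι), SchwartzMap.seminorm ℂ k n (f i),
        fun x => by
          have := htail Set.univ k n x
          rwa [tsum_univ (fun i => iteratedFDeriv ℝ n (f i) x), ← hder] at this⟩ }
  refine ⟨g, fun x => rfl, ?_⟩
  rw [HasSum, SummationFilter.unconditional_filter,
    (schwartz_withSeminorms ℂ E ℂ).tendsto_nhds _ g]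
  rintro ⟨k, n⟩ ε hε
  filter_upwards [(tendsto_tsum_compl_atTop_zero
    (fun i => SchwartzMap.seminorm ℂ k n (f i))).eventually_lt_const hε] with s hs
  refine lt_of_le_of_lt ?_ hs
  refine SchwartzMap.seminorm_le_bound ℂ k n _ (tsum_nonneg fun i => apply_nonneg _ _) fun x => ?_
  have h1 : (⇑(∑ i ∈ s, f i - g) : E → ℂ) = (fun x => ∑ i ∈ s, f i x) - fun x => ∑' i, f i x := by
    ext x
    simp [g]
    rfl
  have h2 : iteratedFDeriv ℝ n (⇑(∑ i ∈ s, f i - g)) x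
      = - ∑' i : ((s : Set ι)ᶜ : Set ι), iteratedFDeriv ℝ n (f i) x := by
    rw [h1, iteratedFDeriv_sub_apply (g := fun x => ∑' i, f i x)
      ((ContDiff.sum fun i _ => (f i).smooth n).contDiffAt) (g.smooth n).contDiffAt, hder,
      iteratedFDeriv_fun_sum_apply fun i _ => ((f i).smooth n).contDiffAt,
      ← (hsd n x).sum_add_tsum_compl (s := s)]
    abel
  rw [h2, norm_neg]
  exact htail _ k n x

theorem schwartz_hasSum {E ι : Type*} [NormedAddCommGroup E] [NormedSpace ℝ E]
    (f : ι → 𝓢(E, ℂ)) (g : 𝓢(E, ℂ))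
    (hf : ∀ k n, Summable fun i => SchwartzMap.seminorm ℂ k n (f i))
    (hg : ∀ x, ∑' i, f i x = g x) : HasSum f g := by
  obtain ⟨g', h1, h2⟩ := schwartz_exists_hasSum f hf
  have : g' = g := by
    ext x
    rw [h1, hg]
  exact this ▸ h2

/-- The increasing family of norms `max_{k, n ≤ N} sup ‖x‖ ^ k ‖D ^ n f(x)‖` on the Schwartz space. -/
noncomputable def schwartzNorm (E : Type*) [NormedAddCommGroup E] [NormedSpace ℝ E] (N : ℕ) :
    Seminorm ℂ 𝓢(E, ℂ) :=
  (Finset.Iic (N, N)).sup (schwartzSeminormFamily ℂ E ℂ)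

section schwartzNorm
variable {E : Type*} [NormedAddCommGroup E] [NormedSpace ℝ E]

theorem continuous_schwartzNorm (N : ℕ) : Continuous (schwartzNorm E N) :=
  Seminorm.continuous (r := 1)
    (((schwartz_withSeminorms ℂ E ℂ).mem_nhds_iff 0 _).2 ⟨Finset.Iic (N, N), 1, one_pos, subset_rfl⟩)

theorem seminorm_le_schwartzNorm {k n N : ℕ} (hk : k ≤ N) (hn : n ≤ N) (f : 𝓢(E, ℂ)) :
    SchwartzMap.seminorm ℂ k n f ≤ schwartzNorm E N f := by
  have hm : (k, n) ∈ Finset.Iic (N, N) := Finset.mem_Iic.2 ⟨hk, hn⟩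
  exact (show schwartzSeminormFamily ℂ E ℂ (k, n) ≤ schwartzNorm E N from
    Finset.le_sup (f := schwartzSeminormFamily ℂ E ℂ) hm) f

theorem schwartzNorm_mono {N M : ℕ} (h : N ≤ M) (f : 𝓢(E, ℂ)) :
    schwartzNorm E N f ≤ schwartzNorm E M f := by
  have hs : Finset.Iic (N, N) ⊆ Finset.Iic (M, M) :=
    Finset.Iic_subset_Iic.2 ⟨h, h⟩
  exact (show schwartzNorm E N ≤ schwartzNorm E M from Finset.sup_mono hs) f

theorem schwartzNorm_le {N : ℕ} {f : 𝓢(E, ℂ)} {M : ℝ} (hM : 0 ≤ M)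
    (h : ∀ k ≤ N, ∀ n ≤ N, ∀ x, ‖x‖ ^ k * ‖iteratedFDeriv ℝ n f x‖ ≤ M) :
    schwartzNorm E N f ≤ M := by
  refine Seminorm.finset_sup_apply_le hM fun i hi => ?_
  have := Finset.mem_Iic.1 hi
  exact SchwartzMap.seminorm_le_bound ℂ i.1 i.2 f hM fun x => h i.1 this.1 i.2 this.2 x

theorem one_add_norm_pow_mul_le {N : ℕ} {k n : ℕ} (hk : k ≤ N) (hn : n ≤ N) (f : 𝓢(E, ℂ)) (x : E) :
    (1 + ‖x‖) ^ k * ‖iteratedFDeriv ℝ n f x‖ ≤ 2 ^ N * schwartzNorm E N f :=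
  one_add_le_sup_seminorm_apply (𝕜 := ℂ) (m := (N, N)) hk hn f x

/-- Because the norms increase, the finite supremum supplied by continuity is absorbed into a single
one of them. -/
theorem exists_le_schwartzNorm (p : Seminorm ℂ 𝓢(E, ℂ)) (hp : Continuous p) :
    ∃ (N : ℕ) (C : ℝ), 0 ≤ C ∧ ∀ f, p f ≤ C * schwartzNorm E N f := by
  obtain ⟨s, C, -, hC⟩ := Seminorm.bound_of_continuous (schwartz_withSeminorms ℂ E ℂ) p hp
  obtain ⟨b, hb⟩ := s.bddAbove
  refine ⟨max b.1 b.2, C, C.2, fun f => (hC f).trans ?_⟩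
  change (C : ℝ) * _ ≤ _
  gcongr
  refine Seminorm.finset_sup_apply_le (apply_nonneg _ _) fun i hi => ?_
  have := hb hi
  exact seminorm_le_schwartzNorm (this.1.trans (le_max_left _ _)) (this.2.trans (le_max_right _ _)) f

theorem exists_schwartzNorm_map_le {E' : Type*} [NormedAddCommGroup E'] [NormedSpace ℝ E']
    (L : 𝓢(E, ℂ) →L[ℂ] 𝓢(E', ℂ)) (N : ℕ) :
    ∃ (K : ℕ) (C : ℝ), 0 ≤ C ∧ ∀ f, schwartzNorm E' N (L f) ≤ C * schwartzNorm E K f :=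
  exists_le_schwartzNorm ((schwartzNorm E' N).comp L.toLinearMap)
    ((continuous_schwartzNorm N).comp L.continuous)

theorem exists_norm_apply_le (L : 𝓢(E, ℂ) →L[ℂ] ℂ) :
    ∃ (K : ℕ) (C : ℝ), 0 ≤ C ∧ ∀ f, ‖L f‖ ≤ C * schwartzNorm E K f :=
  exists_le_schwartzNorm ((normSeminorm ℂ ℂ).comp L.toLinearMap) (by
    change Continuous fun f => ‖L f‖
    fun_prop)

end schwartzNorm

instance {E : Type*} [NormedAddCommGroup E] [NormedSpace ℝ E] :
    (uniformity 𝓢(E, ℂ)).IsCountablyGenerated :=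
  IsUniformAddGroup.uniformity_countably_generated

/-- A sequence whose steps are eventually at most `(1/2) ^ N` in the `N`-th norm telescopes into an
absolutely summable series. Completeness, with a countably generated uniformity, makes the Baire
category theorem available. -/
instance schwartz_completeSpace {E : Type*} [NormedAddCommGroup E] [NormedSpace ℝ E] :
    CompleteSpace 𝓢(E, ℂ) := by
  refine UniformSpace.complete_of_convergent_controlled_sequences
    (fun N => {p : 𝓢(E, ℂ) × 𝓢(E, ℂ) | schwartzNorm E N (p.2 - p.1) < (1 / 2) ^ N})
    (fun N => ?_) fun u hu => ?_
  · rw [uniformity_eq_comap_nhds_zero 𝓢(E, ℂ)]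
    have : {x : 𝓢(E, ℂ) | schwartzNorm E N x < (1 / 2) ^ N} ∈ 𝓝 0 := by
      refine (isOpen_lt (continuous_schwartzNorm N) continuous_const).mem_nhds ?_
      simp
    exact preimage_mem_comap this
  · have hs : ∀ k n, Summable fun i => SchwartzMap.seminorm ℂ k n (u (i + 1) - u i) := by
      intro k n
      have hsum : Summable fun i : ℕ => ((1 : ℝ) / 2) ^ i := summable_geometric_two
      -- From index `max k n` on, the controlling norm dominates the seminorm `(k, n)`; the finitely
      -- many earlier terms do not affect summability.
      refine (summable_nat_add_iff (max k n)).1 (Summable.of_nonneg_of_le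
        (fun i => apply_nonneg _ _) (fun i => ?_) ((summable_nat_add_iff (max k n)).2 hsum))
      refine le_trans ?_ (le_of_lt (hu (i + max k n) (i + max k n) (i + max k n + 1) le_rfl (by omega)))
      exact seminorm_le_schwartzNorm (by omega) (by omega) _
    obtain ⟨g, -, hg⟩ := schwartz_exists_hasSum _ hs
    refine ⟨u 0 + g, ?_⟩
    have := hg.tendsto_sum_nat.const_add (u 0)
    simp only [Finset.sum_range_sub] at this
    simpa using this

/-- An operator into tempered distributions, continuous for pointwise convergence, is jointly
bounded as a bilinear form. -/
theorem exists_joint_bound {E₁ E₂ : Type} [NormedAddCommGroup E₁] [NormedSpace ℝ E₁]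
    [NormedAddCommGroup E₂] [InnerProductSpace ℝ E₂] (T : 𝓢(E₁, ℂ) →L[ℂ] 𝓢'(E₂, ℂ)) :
    ∃ (K N : ℕ) (C : ℝ), 0 ≤ C ∧
      ∀ f g, ‖T f g‖ ≤ C * (1 + schwartzNorm E₁ K f) * schwartzNorm E₂ N g := by
  have hT : ∀ g, Continuous fun f => T f g := fun g =>
    (PointwiseConvergenceCLM.evalCLM (RingHom.id ℂ) ℂ g).continuous.comp T.continuous
  -- The single index `N` is both the constant and the order of the norm, so countably many closed
  -- sets suffice to cover the space.
  let A : ℕ → Set 𝓢(E₁, ℂ) := fun N => {f | ∀ g, ‖T f g‖ ≤ N * schwartzNorm E₂ N g}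
  have hA : ∀ N, IsClosed (A N) := fun N => by
    simp only [A, Set.ofPred_forall]
    exact isClosed_iInter fun g => isClosed_le (hT g).norm continuous_const
  have hU : ⋃ N, A N = Set.univ := by
    refine Set.eq_univ_of_forall fun f => Set.mem_iUnion.2 ?_
    obtain ⟨K, C, hC0, hC⟩ := exists_norm_apply_le (toDual (T f))
    obtain ⟨M, hM⟩ := exists_nat_ge C
    refine ⟨max M K, fun g => (hC g).trans ?_⟩
    have h3 : C ≤ (max M K : ℕ) := hM.trans (mod_cast le_max_left _ _)
    gcongr
    exact schwartzNorm_mono (le_max_right _ _) g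
  -- By Baire some `A N` contains a neighbourhood of a point `x`. Subtracting `T x` moves the bound
  -- to a neighbourhood of zero, at the price of a factor `2`.
  obtain ⟨N, x, hx⟩ := nonempty_interior_of_iUnion_of_closed hA hU
  have h0 : {h | x + h ∈ A N} ∈ 𝓝 (0 : 𝓢(E₁, ℂ)) :=
    (continuous_const_add x).continuousAt.preimage_mem_nhds
      (by simpa using mem_interior_iff_mem_nhds.1 hx)
  obtain ⟨s, r, hr, hs⟩ := ((schwartz_withSeminorms ℂ E₁ ℂ).mem_nhds_iff 0 _).1 h0
  let P := s.sup (schwartzSeminormFamily ℂ E₁ ℂ)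
  have hP : Continuous P := Seminorm.continuous (r := 1)
    (((schwartz_withSeminorms ℂ E₁ ℂ).mem_nhds_iff 0 _).2 ⟨s, 1, one_pos, subset_rfl⟩)
  obtain ⟨K, C, hC0, hC⟩ := exists_le_schwartzNorm P hP
  have hxA := interior_subset hx
  have hbd : ∀ h, P h < r → ∀ g, ‖T h g‖ ≤ 2 * N * schwartzNorm E₂ N g := by
    intro h hh g
    have h1 : x + h ∈ A N := hs (by rwa [Seminorm.mem_ball_zero])
    have h2 : T h g = T (x + h) g - T x g := by
      rw [map_add]
      simp
    rw [h2]
    calc _ ≤ _ := norm_sub_le _ _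
      _ ≤ N * schwartzNorm E₂ N g + N * schwartzNorm E₂ N g := add_le_add (h1 g) (hxA g)
      _ = _ := by ring
  refine ⟨K, N, 2 * (2 * N) / r * (1 + C), by positivity, fun f g => ?_⟩
  have hPf : 0 ≤ P f := apply_nonneg _ _
  have h1 : 0 < r / (2 * (1 + P f)) := by positivity
  -- Scaling by `r / (2 (1 + P f))` brings `f` into the ball. The `1 +` covers the case `P f = 0`
  -- and is the source of `1 + schwartzNorm` in the conclusion.
  have h2 := hbd (((r / (2 * (1 + P f)) : ℝ) : ℂ) • f) (by
    rw [map_smul_eq_mul, Complex.norm_real, Real.norm_of_nonneg h1.le, div_mul_eq_mul_div,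
      div_lt_iff₀ (by positivity)]
    nlinarith) g
  have h3 : T (((r / (2 * (1 + P f)) : ℝ) : ℂ) • f) g
      = ((r / (2 * (1 + P f)) : ℝ) : ℂ) * T f g := by
    rw [map_smul]
    rfl
  rw [h3, norm_mul, Complex.norm_real, Real.norm_of_nonneg h1.le, div_mul_eq_mul_div,
    div_le_iff₀ (by positivity)] at h2
  have h4 : 1 + P f ≤ (1 + C) * (1 + schwartzNorm E₁ K f) := by
    nlinarith [hC f, apply_nonneg (schwartzNorm E₁ K) f]
  have h5 := apply_nonneg (schwartzNorm E₂ N) g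
  rw [← mul_le_mul_iff_right₀ hr]
  calc _ ≤ _ := h2
    _ = 2 * (2 * N) * schwartzNorm E₂ N g * (1 + P f) := by ring
    _ ≤ 2 * (2 * N) * schwartzNorm E₂ N g * ((1 + C) * (1 + schwartzNorm E₁ K f)) := by gcongr
    _ = _ := by field_simp

/-! ### Uniform bounds for tensor products and partial pairings -/

theorem norm_withLp_le {V₁ V₂ : Type*} [NormedAddCommGroup V₁] [NormedAddCommGroup V₂]
    (p : WithLp 2 (V₁ × V₂)) : ‖p‖ ≤ ‖p.fst‖ + ‖p.snd‖ := by
  have : p = WithLp.toLp 2 (p.fst, (0 : V₂)) + WithLp.toLp 2 ((0 : V₁), p.snd) :=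
    congrArg (WithLp.toLp 2) (show (p.fst, p.snd) = (p.fst, 0) + (0, p.snd) by simp)
  calc ‖p‖ = _ := congrArg _ this
    _ ≤ _ := norm_add_le _ _
    _ = _ := by rw [WithLp.norm_toLp_fst, WithLp.norm_toLp_snd]

theorem norm_iteratedFDeriv_comp_le_of_norm_le_one {E E' : Type*} [NormedAddCommGroup E]
    [NormedSpace ℝ E] [NormedAddCommGroup E'] [NormedSpace ℝ E'] (f : 𝓢(E, ℂ)) (L : E' →L[ℝ] E)
    (hL : ‖L‖ ≤ 1) (n : ℕ) (x : E') :
    ‖iteratedFDeriv ℝ n (f ∘ L) x‖ ≤ ‖iteratedFDeriv ℝ n f (L x)‖ := by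
  rw [ContinuousLinearMap.iteratedFDeriv_comp_right _ (f.smooth ⊤) x (mod_cast le_top)]
  refine (ContinuousMultilinearMap.norm_compContinuousLinearMap_le _ _).trans ?_
  exact mul_le_of_le_one_right (norm_nonneg _)
    (Finset.prod_le_one (fun _ _ => norm_nonneg _) fun _ _ => hL)

section
variable {V₁ V₂ : Type} [NormedAddCommGroup V₁] [InnerProductSpace ℝ V₁]
  [NormedAddCommGroup V₂] [InnerProductSpace ℝ V₂]

/-- Leibniz rule, with `‖p‖ ≤ (1 + ‖x‖)(1 + ‖y‖)` distributing the polynomial weight. One factor `2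
^ N` bounds the sum of binomial coefficients; the other two come from replacing `‖·‖ ^ k` by `(1 +
‖·‖) ^ k`. -/
theorem schwartzNorm_tensorS_le (N : ℕ) (f : 𝓢(V₁, ℂ)) (g : 𝓢(V₂, ℂ)) :
    schwartzNorm _ N (tensorS f g)
      ≤ 2 ^ N * (2 ^ N * schwartzNorm V₁ N f) * (2 ^ N * schwartzNorm V₂ N g) := by
  have hf0 := apply_nonneg (schwartzNorm V₁ N) f
  have hg0 := apply_nonneg (schwartzNorm V₂ N) g
  refine schwartzNorm_le (by positivity) fun k hk n hn p => ?_
  have hf1 : ‖WithLp.fstL 2 ℝ V₁ V₂‖ ≤ 1 := ContinuousLinearMap.opNorm_le_bound _ zero_le_one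
    fun p => by rw [one_mul]; exact WithLp.norm_fst_le (p := 2) (x := p)
  have hg1 : ‖WithLp.sndL 2 ℝ V₁ V₂‖ ≤ 1 := ContinuousLinearMap.opNorm_le_bound _ zero_le_one
    fun p => by rw [one_mul]; exact WithLp.norm_snd_le (p := 2) (x := p)
  have hf : ContDiff ℝ ∞ (f ∘ WithLp.fstL 2 ℝ V₁ V₂) :=
    (f.smooth ⊤).comp (ContinuousLinearMap.contDiff _)
  have hg : ContDiff ℝ ∞ (g ∘ WithLp.sndL 2 ℝ V₁ V₂) :=
    (g.smooth ⊤).comp (ContinuousLinearMap.contDiff _)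
  have hA : ∀ i ≤ n, (1 + ‖p.fst‖) ^ k * ‖iteratedFDeriv ℝ i (f ∘ WithLp.fstL 2 ℝ V₁ V₂) p‖
      ≤ 2 ^ N * schwartzNorm V₁ N f := fun i hi =>
    (mul_le_mul_of_nonneg_left (norm_iteratedFDeriv_comp_le_of_norm_le_one f _ hf1 i p)
      (by positivity)).trans (one_add_norm_pow_mul_le hk (hi.trans hn) f p.fst)
  have hB : ∀ i ≤ n, (1 + ‖p.snd‖) ^ k * ‖iteratedFDeriv ℝ i (g ∘ WithLp.sndL 2 ℝ V₁ V₂) p‖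
      ≤ 2 ^ N * schwartzNorm V₂ N g := fun i hi =>
    (mul_le_mul_of_nonneg_left (norm_iteratedFDeriv_comp_le_of_norm_le_one g _ hg1 i p)
      (by positivity)).trans (one_add_norm_pow_mul_le hk (hi.trans hn) g p.snd)
  have hp : ‖p‖ ≤ (1 + ‖p.fst‖) * (1 + ‖p.snd‖) := by
    nlinarith [norm_withLp_le p, norm_nonneg p.fst, norm_nonneg p.snd]
  have hm := norm_iteratedFDeriv_mul_le hf hg p (n := n) (mod_cast le_top)
  calc _ ≤ ((1 + ‖p.fst‖) * (1 + ‖p.snd‖)) ^ k * ∑ i ∈ Finset.range (n + 1), (n.choose i : ℝ) *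
        ‖iteratedFDeriv ℝ i (f ∘ WithLp.fstL 2 ℝ V₁ V₂) p‖ *
        ‖iteratedFDeriv ℝ (n - i) (g ∘ WithLp.sndL 2 ℝ V₁ V₂) p‖ := by
        gcongr
        exact hm
    _ = ∑ i ∈ Finset.range (n + 1), (n.choose i : ℝ) *
        (((1 + ‖p.fst‖) ^ k * ‖iteratedFDeriv ℝ i (f ∘ WithLp.fstL 2 ℝ V₁ V₂) p‖) *
        ((1 + ‖p.snd‖) ^ k * ‖iteratedFDeriv ℝ (n - i) (g ∘ WithLp.sndL 2 ℝ V₁ V₂) p‖)) := by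
        rw [mul_pow, Finset.mul_sum]
        exact Finset.sum_congr rfl fun i _ => by ring
    _ ≤ ∑ i ∈ Finset.range (n + 1), (n.choose i : ℝ) *
        ((2 ^ N * schwartzNorm V₁ N f) * (2 ^ N * schwartzNorm V₂ N g)) :=
      Finset.sum_le_sum fun i hi => by
        refine mul_le_mul_of_nonneg_left ?_ (Nat.cast_nonneg _)
        exact mul_le_mul (hA i (by have := Finset.mem_range.1 hi; omega)) (hB (n - i) (by omega))
          (by positivity) (by positivity)
    _ = 2 ^ n * ((2 ^ N * schwartzNorm V₁ N f) * (2 ^ N * schwartzNorm V₂ N g)) := by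
        rw [← Finset.sum_mul]
        congr 1
        exact_mod_cast Nat.sum_range_choose n
    _ ≤ 2 ^ N * ((2 ^ N * schwartzNorm V₁ N f) * (2 ^ N * schwartzNorm V₂ N g)) := by
        gcongr
        norm_num
    _ = _ := by ring

/-- The operators `partialPairing G` are bounded uniformly over equicontinuous sets of `G`. -/
theorem exists_schwartzNorm_partialPairing_le [FiniteDimensional ℝ V₁] (K : ℕ) (C₀ : ℝ)
    (hC₀ : 0 ≤ C₀) (N : ℕ) :
    ∃ (K' : ℕ) (C : ℝ), 0 ≤ C ∧ ∀ G : 𝓢(V₂, ℂ) →L[ℂ] ℂ, (∀ g, ‖G g‖ ≤ C₀ * schwartzNorm V₂ K g) →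
      ∀ Φ : 𝓢(WithLp 2 (V₁ × V₂), ℂ),
        schwartzNorm V₁ N (partialPairing G Φ) ≤ C * schwartzNorm _ K' Φ := by
  let e := fun i => innerSL ℝ (stdOrthonormalBasis ℝ V₁ i)
  let L := fun i => LineDeriv.lineDerivOpCLM ℂ 𝓢(WithLp 2 (V₁ × V₂), ℂ)
      (WithLp.toLp 2 (stdOrthonormalBasis ℝ V₁ i, (0 : V₂)))
  -- Derivatives in `x` pass through the pairing onto `Φ`. In the induction on the order, the bound
  -- on `G` therefore enters only at order zero, which makes the constants uniform in `G`.
  have hfd : ∀ (G : 𝓢(V₂, ℂ) →L[ℂ] ℂ) (Φ : 𝓢(WithLp 2 (V₁ × V₂), ℂ)),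
      fderiv ℝ (partialPairing G Φ) = fun x => ∑ i,
      (ContinuousLinearMap.smulRightL ℝ V₁ ℂ (e i) ∘ partialPairing G (L i Φ)) x := by
    intro G Φ
    ext1 x
    exact (hasFDerivAt_slice G Φ x).fderiv
  have main : ∀ n k : ℕ, ∃ (K' : ℕ) (C : ℝ), 0 ≤ C ∧
      ∀ G : 𝓢(V₂, ℂ) →L[ℂ] ℂ, (∀ g, ‖G g‖ ≤ C₀ * schwartzNorm V₂ K g) →
      ∀ (Φ : 𝓢(WithLp 2 (V₁ × V₂), ℂ)) (x : V₁),
        ‖x‖ ^ k * ‖iteratedFDeriv ℝ n (partialPairing G Φ) x‖ ≤ C * schwartzNorm _ K' Φ := by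
    intro n k
    induction n with
    | zero =>
      obtain ⟨r, hr, hrb⟩ := slice_bound (V₁ := V₁) (schwartzNorm V₂ K)
        (continuous_schwartzNorm K) k
      obtain ⟨K', C, hC, hb⟩ := exists_le_schwartzNorm r hr
      refine ⟨K', C₀ * C, by positivity, fun G hG Φ x => ?_⟩
      rw [norm_iteratedFDeriv_zero]
      calc _ ≤ ‖x‖ ^ k * (C₀ * schwartzNorm V₂ K (sliceCLM x Φ)) := by
            gcongr
            exact hG _
        _ = C₀ * (‖x‖ ^ k * schwartzNorm V₂ K (sliceCLM x Φ)) := by ring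
        _ ≤ C₀ * (C * schwartzNorm _ K' Φ) :=
            mul_le_mul_of_nonneg_left ((hrb Φ x).trans (hb Φ)) hC₀
        _ = _ := by ring
    | succ n ih =>
      obtain ⟨K', C, hC, hb⟩ := ih
      choose M D hD hM using fun i => exists_schwartzNorm_map_le (L i) K'
      -- There are finitely many directions, so one norm order serves for all of them.
      obtain ⟨B, hB⟩ := (Set.finite_range M).bddAbove
      refine ⟨B, ∑ i, ‖ContinuousLinearMap.smulRightL ℝ V₁ ℂ (e i)‖ * (C * D i),
        Finset.sum_nonneg fun i _ => mul_nonneg (by positivity) (mul_nonneg hC (hD i)),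
        fun G hG Φ x => ?_⟩
      have hsm : ∀ i, ContDiff ℝ n (ContinuousLinearMap.smulRightL ℝ V₁ ℂ (e i) ∘
          partialPairing G (L i Φ)) := fun i =>
        (ContinuousLinearMap.contDiff _).comp ((partialPairing G (L i Φ)).smooth n)
      rw [← norm_iteratedFDeriv_fderiv, hfd, iteratedFDeriv_fun_sum_apply
        (fun i _ => (hsm i).contDiffAt)]
      calc _ ≤ ‖x‖ ^ k * ∑ i, ‖ContinuousLinearMap.smulRightL ℝ V₁ ℂ (e i)‖ *
            ‖iteratedFDeriv ℝ n (partialPairing G (L i Φ)) x‖ := by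
            gcongr
            refine (norm_sum_le _ _).trans (Finset.sum_le_sum fun i _ => ?_)
            exact ContinuousLinearMap.norm_iteratedFDeriv_comp_left _
              ((partialPairing G (L i Φ)).smooth n).contDiffAt le_rfl
        _ = ∑ i, ‖ContinuousLinearMap.smulRightL ℝ V₁ ℂ (e i)‖ *
            (‖x‖ ^ k * ‖iteratedFDeriv ℝ n (partialPairing G (L i Φ)) x‖) := by
            rw [Finset.mul_sum]
            exact Finset.sum_congr rfl fun i _ => by ring
        _ ≤ ∑ i, ‖ContinuousLinearMap.smulRightL ℝ V₁ ℂ (e i)‖ * (C * (D i * schwartzNorm _ B Φ)) :=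
          Finset.sum_le_sum fun i _ => by
            refine mul_le_mul_of_nonneg_left ((hb G hG _ x).trans
              (mul_le_mul_of_nonneg_left ?_ hC)) (by positivity)
            refine (hM i Φ).trans ?_
            have := hD i
            gcongr
            exact schwartzNorm_mono (hB ⟨i, rfl⟩) Φ
        _ = _ := by
            rw [Finset.sum_mul]
            exact Finset.sum_congr rfl fun i _ => by ring
  choose K' C hC hb using fun i : ℕ × ℕ => main i.2 i.1
  let s := Finset.Iic (N, N)
  refine ⟨s.sup K', ∑ i ∈ s, C i, Finset.sum_nonneg fun i _ => hC i, fun G hG Φ => ?_⟩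
  have hS := apply_nonneg (schwartzNorm (WithLp 2 (V₁ × V₂)) (s.sup K')) Φ
  refine schwartzNorm_le (mul_nonneg (Finset.sum_nonneg fun i _ => hC i) hS) fun k hk n hn x => ?_
  have hm : (k, n) ∈ s := Finset.mem_Iic.2 ⟨hk, hn⟩
  calc _ ≤ C (k, n) * schwartzNorm _ (K' (k, n)) Φ := hb (k, n) G hG Φ x
    _ ≤ (∑ i ∈ s, C i) * schwartzNorm _ (s.sup K') Φ := by
      gcongr
      · exact Finset.sum_nonneg fun i _ => hC i
      · exact Finset.single_le_sum (fun i _ => hC i) hm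
      · exact schwartzNorm_mono (Finset.le_sup hm) Φ

end

/-! ### Atomic decompositions, their tensor products, and the kernel theorem -/

/-- An unconditional atomic decomposition `f = ∑ᵢ cᵢ(f) eᵢ` of the Schwartz space, with rapidly
decreasing coefficients and atoms of polynomial growth with respect to a weight. -/
structure AtomicSystem (V : Type) [NormedAddCommGroup V] [NormedSpace ℝ V] where
  /-- The index set. -/
  idx : Type
  /-- The weight. -/
  weight : idx → ℝ
  one_le_weight : ∀ i, 1 ≤ weight i
  summable_weight : ∃ M : ℕ, Summable fun i => (weight i ^ M)⁻¹
  /-- The atoms. -/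
  atom : idx → 𝓢(V, ℂ)
  atom_le : ∀ N, ∃ (M : ℕ) (C : ℝ), 0 ≤ C ∧ ∀ i, schwartzNorm V N (atom i) ≤ C * weight i ^ M
  /-- The coefficient functionals. -/
  coef : idx → 𝓢(V, ℂ) →L[ℂ] ℂ
  coef_le : ∀ N : ℕ, ∃ (K : ℕ) (C : ℝ), 0 ≤ C ∧
    ∀ i f, weight i ^ N * ‖coef i f‖ ≤ C * schwartzNorm V K f
  tsum_eq : ∀ f x, ∑' i, coef i f * atom i x = f x

namespace AtomicSystem

section
variable {V : Type} [NormedAddCommGroup V] [NormedSpace ℝ V] (A : AtomicSystem V)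

theorem weight_pos (i : A.idx) : 0 < A.weight i := one_pos.trans_le (A.one_le_weight i)

/-- Spending `M₀` additional powers of the weight, where `weight ^ (-M₀)` is summable, turns rapid
decay of the coefficients into a summable majorant. -/
theorem exists_bound (M : ℕ) : ∃ (K : ℕ) (b : A.idx → ℝ), (∀ i, 0 ≤ b i) ∧ Summable b ∧
    ∀ i f, A.weight i ^ M * ‖A.coef i f‖ ≤ b i * schwartzNorm V K f := by
  obtain ⟨M₀, hM₀⟩ := A.summable_weight
  obtain ⟨K, C, hC, h⟩ := A.coef_le (M + M₀)
  refine ⟨K, fun i => C * (A.weight i ^ M₀)⁻¹, fun i => ?_, hM₀.mul_left C, fun i f => ?_⟩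
  · have := A.weight_pos i
    positivity
  · have h0 : 0 < A.weight i ^ M₀ := pow_pos (A.weight_pos i) _
    have := h i f
    rw [pow_add] at this
    rw [mul_right_comm, ← div_eq_mul_inv, le_div_iff₀ h0]
    linarith

theorem exists_bound_coef_mul (M : ℕ) (C : ℝ) (hC : 0 ≤ C) :
    ∃ (K : ℕ) (b : A.idx → ℝ), (∀ i, 0 ≤ b i) ∧ Summable b ∧ ∀ (B : A.idx → ℝ), (∀ i, 0 ≤ B i) →
      (∀ i, B i ≤ C * A.weight i ^ M) → ∀ i f, ‖A.coef i f‖ * B i ≤ b i * schwartzNorm V K f := by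
  obtain ⟨K, b, hb0, hb, h⟩ := A.exists_bound M
  refine ⟨K, fun i => C * b i, fun i => mul_nonneg hC (hb0 i), hb.mul_left C,
    fun B _ hB i f => ?_⟩
  calc _ ≤ ‖A.coef i f‖ * (C * A.weight i ^ M) := by
        gcongr
        exact hB i
    _ = C * (A.weight i ^ M * ‖A.coef i f‖) := by ring
    _ ≤ C * (b i * schwartzNorm V K f) := mul_le_mul_of_nonneg_left (h i f) hC
    _ = _ := by ring

/-- The structure asks only for pointwise reconstruction. The weights upgrade it to convergence in
the Schwartz topology, so continuous functionals may be applied term by term. -/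
theorem hasSum (f : 𝓢(V, ℂ)) : HasSum (fun i => A.coef i f • A.atom i) f := by
  refine schwartz_hasSum _ f (fun k n => ?_) fun x => A.tsum_eq f x
  obtain ⟨M, C, hC, h⟩ := A.atom_le (max k n)
  obtain ⟨K, b, hb0, hb, hK⟩ := A.exists_bound_coef_mul M C hC
  refine Summable.of_nonneg_of_le (fun i => apply_nonneg _ _) (fun i => ?_)
    (hb.mul_right (schwartzNorm V K f))
  rw [map_smul_eq_mul]
  refine le_trans ?_ (hK (fun i => schwartzNorm V (max k n) (A.atom i))
    (fun i => apply_nonneg _ _) h i f)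
  gcongr
  exact seminorm_le_schwartzNorm (le_max_left _ _) (le_max_right _ _) _

theorem hasSum_apply (L : 𝓢(V, ℂ) →L[ℂ] ℂ) (f : 𝓢(V, ℂ)) :
    HasSum (fun i => A.coef i f * L (A.atom i)) (L f) := by
  simpa using (A.hasSum f).mapL L

/-- The continuous functional with given polynomially bounded values on the atoms. -/
theorem exists_functional (M : ℕ) (C : ℝ) (hC : 0 ≤ C) (b : A.idx → ℂ)
    (hb : ∀ i, ‖b i‖ ≤ C * A.weight i ^ M) :
    ∃ L : 𝓢(V, ℂ) →L[ℂ] ℂ, ∀ f, HasSum (fun i => A.coef i f * b i) (L f) := by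
  obtain ⟨K, β, hβ0, hβ, h⟩ := A.exists_bound_coef_mul M C hC
  have hle : ∀ f i, ‖A.coef i f * b i‖ ≤ β i * schwartzNorm V K f := fun f i => by
    rw [norm_mul]
    exact h (fun i => ‖b i‖) (fun i => norm_nonneg _) hb i f
  have hs : ∀ f, Summable fun i => A.coef i f * b i := fun f =>
    Summable.of_norm_bounded (hβ.mul_right _) (hle f)
  refine ⟨mkCLMtoNormedSpace (𝕜 := ℂ) (σ := RingHom.id ℂ) (fun f => ∑' i, A.coef i f * b i)
    (fun f g => ?_) (fun a f => ?_) ⟨Finset.Iic (K, K), ∑' i, β i, tsum_nonneg hβ0, fun f => ?_⟩,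
    fun f => (hs f).hasSum⟩
  · rw [← (hs f).tsum_add (hs g)]
    simp only [map_add, add_mul]
  · simp only [map_smul, smul_eq_mul, mul_assoc, tsum_mul_left, RingHom.id_apply]
  · rw [← tsum_mul_right]
    exact tsum_of_norm_bounded (hβ.mul_right _).hasSum (hle f)

/-- Transport of an atomic system along a continuous linear equivalence. -/
noncomputable def map {V' : Type} [NormedAddCommGroup V'] [NormedSpace ℝ V'] (φ : V' ≃L[ℝ] V) :
    AtomicSystem V' where
  idx := A.idx
  weight := A.weight
  one_le_weight := A.one_le_weight
  summable_weight := A.summable_weight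
  atom i := compCLMOfContinuousLinearEquiv ℂ φ (A.atom i)
  atom_le N := by
    obtain ⟨K, C, hC, h⟩ := exists_schwartzNorm_map_le (compCLMOfContinuousLinearEquiv ℂ φ) N
    obtain ⟨M, D, hD, h'⟩ := A.atom_le K
    refine ⟨M, C * D, by positivity, fun i => (h _).trans ?_⟩
    rw [mul_assoc]
    gcongr
    exact h' i
  coef i := A.coef i ∘L compCLMOfContinuousLinearEquiv ℂ φ.symm
  coef_le N := by
    obtain ⟨K, C, hC, h⟩ := A.coef_le N
    obtain ⟨M, D, hD, h'⟩ := exists_schwartzNorm_map_le (compCLMOfContinuousLinearEquiv ℂ φ.symm) K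
    refine ⟨M, C * D, by positivity, fun i f => (h i _).trans ?_⟩
    rw [mul_assoc]
    gcongr
    exact h' f
  tsum_eq f x := by
    have := A.tsum_eq (compCLMOfContinuousLinearEquiv ℂ φ.symm f) (φ x)
    simpa using this

end

section
variable {V₁ V₂ : Type} [NormedAddCommGroup V₁] [InnerProductSpace ℝ V₁]
  [NormedAddCommGroup V₂] [InnerProductSpace ℝ V₂] (A : AtomicSystem V₁) (B : AtomicSystem V₂)

theorem exists_summable_prod : ∃ M : ℕ, Summable fun i : A.idx × B.idx =>
    ((A.weight i.1 * B.weight i.2) ^ M)⁻¹ := by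
  obtain ⟨M, hM⟩ := A.summable_weight
  obtain ⟨N, hN⟩ := B.summable_weight
  refine ⟨max M N, Summable.of_nonneg_of_le (fun i => ?_) (fun i => ?_)
    (hM.mul_of_nonneg hN (fun i => ?_) (fun i => ?_))⟩
  · exact inv_nonneg.2 (pow_nonneg (mul_pos (A.weight_pos _) (B.weight_pos _)).le _)
  · rw [mul_pow, mul_inv]
    have h1 := A.weight_pos i.1
    have h2 := B.weight_pos i.2
    gcongr
    · exact A.one_le_weight _
    · exact le_max_left _ _
    · exact B.one_le_weight _
    · exact le_max_right _ _
  · exact inv_nonneg.2 (pow_nonneg (A.weight_pos _).le _)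
  · exact inv_nonneg.2 (pow_nonneg (B.weight_pos _).le _)
variable [FiniteDimensional ℝ V₁]

/-- The rescaled functionals `weight ^ N • coef` of the second system are equicontinuous, so the
uniform bound on partial pairings applies to them. This gives decay in the second index, while
`A.coef_le` gives it in the first. -/
theorem exists_coef_prod_le (N : ℕ) : ∃ (K : ℕ) (C : ℝ), 0 ≤ C ∧
    ∀ (i : A.idx × B.idx) (Φ : 𝓢(WithLp 2 (V₁ × V₂), ℂ)), (A.weight i.1 * B.weight i.2) ^ N *
      ‖(A.coef i.1 ∘L partialPairing (B.coef i.2)) Φ‖ ≤ C * schwartzNorm _ K Φ := by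
  obtain ⟨K₁, C₁, h1, hA⟩ := A.coef_le N
  obtain ⟨K₂, C₂, h2, hB⟩ := B.coef_le N
  obtain ⟨K, C, hC, h⟩ := exists_schwartzNorm_partialPairing_le (V₁ := V₁) (V₂ := V₂) K₂ C₂ h2 K₁
  refine ⟨K, C₁ * C, by positivity, fun i Φ => ?_⟩
  have hw := pow_pos (B.weight_pos i.2) N
  have h3 : schwartzNorm V₁ K₁ (partialPairing (((B.weight i.2 ^ N : ℝ) : ℂ) • B.coef i.2) Φ)
      = B.weight i.2 ^ N * schwartzNorm V₁ K₁ (partialPairing (B.coef i.2) Φ) := by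
    have : partialPairing (((B.weight i.2 ^ N : ℝ) : ℂ) • B.coef i.2) Φ
        = ((B.weight i.2 ^ N : ℝ) : ℂ) • partialPairing (B.coef i.2) Φ := rfl
    rw [this, map_smul_eq_mul, Complex.norm_real, Real.norm_of_nonneg hw.le]
  have h4 := h (((B.weight i.2 ^ N : ℝ) : ℂ) • B.coef i.2) (fun g => by
    have := hB i.2 g
    rwa [smul_apply, norm_smul, Complex.norm_real,
      Real.norm_of_nonneg hw.le]) Φ
  rw [h3] at h4
  calc _ = B.weight i.2 ^ N * (A.weight i.1 ^ N *
        ‖A.coef i.1 (partialPairing (B.coef i.2) Φ)‖) := by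
        rw [mul_pow]
        simp only [ContinuousLinearMap.comp_apply]
        ring
    _ ≤ B.weight i.2 ^ N * (C₁ * schwartzNorm V₁ K₁ (partialPairing (B.coef i.2) Φ)) := by
        exact mul_le_mul_of_nonneg_left (hA _ _) hw.le
    _ = C₁ * (B.weight i.2 ^ N * schwartzNorm V₁ K₁ (partialPairing (B.coef i.2) Φ)) := by ring
    _ ≤ C₁ * (C * schwartzNorm _ K Φ) := by gcongr
    _ = _ := by ring
theorem summable_prod (M : ℕ) (C : ℝ) (b : A.idx × B.idx → ℂ)
    (hb : ∀ i, ‖b i‖ ≤ C * (A.weight i.1 * B.weight i.2) ^ M) (Φ : 𝓢(WithLp 2 (V₁ × V₂), ℂ)) :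
    Summable fun i : A.idx × B.idx => A.coef i.1 (partialPairing (B.coef i.2) Φ) * b i := by
  obtain ⟨M₀, hM₀⟩ := A.exists_summable_prod B
  obtain ⟨K, D, hD, h⟩ := A.exists_coef_prod_le B (M + M₀)
  refine Summable.of_norm_bounded (hM₀.mul_left (D * schwartzNorm _ K Φ * C)) fun i => ?_
  have hw : 0 < A.weight i.1 * B.weight i.2 := mul_pos (A.weight_pos _) (B.weight_pos _)
  have hi := h i Φ
  rw [ContinuousLinearMap.comp_apply, pow_add] at hi
  have hC : 0 ≤ C := by
    have := (norm_nonneg _).trans (hb i)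
    exact nonneg_of_mul_nonneg_left this (pow_pos hw M)
  rw [norm_mul, ← div_eq_mul_inv, le_div_iff₀ (pow_pos hw _)]
  calc _ ≤ ‖A.coef i.1 (partialPairing (B.coef i.2) Φ)‖ *
        (C * (A.weight i.1 * B.weight i.2) ^ M) * (A.weight i.1 * B.weight i.2) ^ M₀ := by
        gcongr
        exact hb i
    _ = C * ((A.weight i.1 * B.weight i.2) ^ M * (A.weight i.1 * B.weight i.2) ^ M₀ *
        ‖A.coef i.1 (partialPairing (B.coef i.2) Φ)‖) := by ring
    _ ≤ C * (D * schwartzNorm _ K Φ) := mul_le_mul_of_nonneg_left hi hC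
    _ = _ := by ring

/-- By absolute summability the first index can be summed first. For fixed `j` this reconstructs
`partialPairing (B.coef j) Φ` at `x`, which is by definition the `j`-th coefficient of the slice
`Φ(x, ·)`. The sum over `j` then reconstructs the slice. -/
theorem tsum_prod_eq (Φ : 𝓢(WithLp 2 (V₁ × V₂), ℂ)) (p : WithLp 2 (V₁ × V₂)) :
    ∑' i : A.idx × B.idx, (A.coef i.1 ∘L partialPairing (B.coef i.2)) Φ *
      tensorS (A.atom i.1) (B.atom i.2) p = Φ p := by
  obtain ⟨M₁, C₁, h1, hA⟩ := A.atom_le 0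
  obtain ⟨M₂, C₂, h2, hB⟩ := B.atom_le 0
  have hA' : ∀ i x, ‖A.atom i x‖ ≤ C₁ * A.weight i ^ max M₁ M₂ := fun i x => by
    refine ((norm_le_seminorm ℂ _ x).trans ((seminorm_le_schwartzNorm le_rfl le_rfl _).trans
      (hA i))).trans ?_
    gcongr
    · exact A.one_le_weight i
    · exact le_max_left _ _
  have hB' : ∀ i x, ‖B.atom i x‖ ≤ C₂ * B.weight i ^ max M₁ M₂ := fun i x => by
    refine ((norm_le_seminorm ℂ _ x).trans ((seminorm_le_schwartzNorm le_rfl le_rfl _).trans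
      (hB i))).trans ?_
    gcongr
    · exact B.one_le_weight i
    · exact le_max_right _ _
  have hs := A.summable_prod B (max M₁ M₂) (C₁ * C₂)
    (fun i => tensorS (A.atom i.1) (B.atom i.2) p) (fun i => by
      change ‖A.atom i.1 p.fst * B.atom i.2 p.snd‖ ≤ _
      have hw := A.weight_pos i.1
      calc _ = ‖A.atom i.1 p.fst‖ * ‖B.atom i.2 p.snd‖ := norm_mul _ _
        _ ≤ (C₁ * A.weight i.1 ^ max M₁ M₂) * (C₂ * B.weight i.2 ^ max M₁ M₂) :=
          mul_le_mul (hA' _ _) (hB' _ _) (norm_nonneg _) (by positivity)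
        _ = _ := by rw [mul_pow]; ring) Φ
  have hs' := (Equiv.prodComm B.idx A.idx).summable_iff.2 hs
  calc _ = ∑' i : B.idx × A.idx, A.coef i.2 (partialPairing (B.coef i.1) Φ) *
        (A.atom i.2 p.fst * B.atom i.1 p.snd) := ((Equiv.prodComm B.idx A.idx).tsum_eq _).symm
    _ = ∑' j, ∑' i, A.coef i (partialPairing (B.coef j) Φ) *
        (A.atom i p.fst * B.atom j p.snd) := hs'.tsum_prod
    _ = ∑' j, B.coef j (sliceCLM p.fst Φ) * B.atom j p.snd := by
        congr 1
        ext j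
        simp only [← mul_assoc]
        rw [tsum_mul_right, A.tsum_eq]
        rfl
    _ = _ := B.tsum_eq _ _

/-- The tensor product of two atomic systems. -/
noncomputable def prod : AtomicSystem (WithLp 2 (V₁ × V₂)) where
  idx := A.idx × B.idx
  weight i := A.weight i.1 * B.weight i.2
  one_le_weight i := one_le_mul_of_one_le_of_one_le (A.one_le_weight _) (B.one_le_weight _)
  summable_weight := A.exists_summable_prod B
  atom i := tensorS (A.atom i.1) (B.atom i.2)
  atom_le N := by
    obtain ⟨M₁, C₁, h1, hA⟩ := A.atom_le N
    obtain ⟨M₂, C₂, h2, hB⟩ := B.atom_le N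
    refine ⟨max M₁ M₂, 2 ^ N * (2 ^ N * C₁) * (2 ^ N * C₂), by positivity, fun i => ?_⟩
    have hi := hA i.1
    have hj := hB i.2
    have h3 : A.weight i.1 ^ M₁ ≤ A.weight i.1 ^ max M₁ M₂ :=
      pow_le_pow_right₀ (A.one_le_weight _) (le_max_left _ _)
    have h4 : B.weight i.2 ^ M₂ ≤ B.weight i.2 ^ max M₁ M₂ :=
      pow_le_pow_right₀ (B.one_le_weight _) (le_max_right _ _)
    have h5 := A.weight_pos i.1
    have h6 := B.weight_pos i.2
    calc _ ≤ _ := schwartzNorm_tensorS_le N _ _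
      _ ≤ 2 ^ N * (2 ^ N * (C₁ * A.weight i.1 ^ max M₁ M₂)) *
          (2 ^ N * (C₂ * B.weight i.2 ^ max M₁ M₂)) := by
          gcongr
          · exact hi.trans (by gcongr)
          · exact hj.trans (by gcongr)
      _ = _ := by rw [mul_pow]; ring
  coef i := A.coef i.1 ∘L partialPairing (B.coef i.2)
  coef_le := A.exists_coef_prod_le B
  tsum_eq := A.tsum_prod_eq B

/-- **Schwartz kernel theorem**, existence. -/
theorem exists_kernel (A : AtomicSystem V₁) (B : AtomicSystem V₂)
    (T : 𝓢(V₂, ℂ) →L[ℂ] 𝓢'(V₁, ℂ)) :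
    ∃ K : 𝓢'(WithLp 2 (V₁ × V₂), ℂ), ∀ f g, K (tensorS f g) = T g f := by
  obtain ⟨k, n, C, hC, hT⟩ := exists_joint_bound T
  obtain ⟨M₁, C₁, h1, hA⟩ := A.atom_le n
  obtain ⟨M₂, C₂, h2, hB⟩ := B.atom_le k
  -- The joint bound gives the matrix entries of `T` polynomial growth in the product weight, which
  -- is what `exists_functional` needs.
  have hb : ∀ i : (A.prod B).idx, ‖T (B.atom i.2) (A.atom i.1)‖
      ≤ C * (1 + C₂) * C₁ * (A.prod B).weight i ^ (max M₁ M₂) := fun i => by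
    have hA1 : A.weight i.1 ^ M₁ ≤ A.weight i.1 ^ max M₁ M₂ :=
      pow_le_pow_right₀ (A.one_le_weight _) (le_max_left _ _)
    have hB1 : B.weight i.2 ^ M₂ ≤ B.weight i.2 ^ max M₁ M₂ :=
      pow_le_pow_right₀ (B.one_le_weight _) (le_max_right _ _)
    have hB2 : 1 ≤ B.weight i.2 ^ max M₁ M₂ := one_le_pow₀ (B.one_le_weight _)
    have hw := A.weight_pos i.1
    have hw' := B.weight_pos i.2
    have h3 : 1 + schwartzNorm V₂ k (B.atom i.2) ≤ (1 + C₂) * B.weight i.2 ^ max M₁ M₂ := by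
      have := (hB i.2).trans (mul_le_mul_of_nonneg_left hB1 h2)
      linarith
    have h4 : schwartzNorm V₁ n (A.atom i.1) ≤ C₁ * A.weight i.1 ^ max M₁ M₂ :=
      (hA i.1).trans (mul_le_mul_of_nonneg_left hA1 h1)
    have h5 := apply_nonneg (schwartzNorm V₁ n) (A.atom i.1)
    calc _ ≤ _ := hT _ _
      _ ≤ C * ((1 + C₂) * B.weight i.2 ^ max M₁ M₂) * (C₁ * A.weight i.1 ^ max M₁ M₂) :=
        mul_le_mul (mul_le_mul_of_nonneg_left h3 hC) h4 h5 (by positivity)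
      _ = C * (1 + C₂) * C₁ * (A.weight i.1 * B.weight i.2) ^ max M₁ M₂ := by
        rw [mul_pow]; ring
  obtain ⟨L, hL⟩ := (A.prod B).exists_functional _ _ (by positivity) _ hb
  refine ⟨ContinuousLinearMap.toPointwiseConvergenceCLM ℂ (RingHom.id ℂ) _ ℂ L, fun f g => ?_⟩
  change L (tensorS f g) = _
  have hs := (hL (tensorS f g)).summable
  have hc : ∀ i j, A.coef i (partialPairing (B.coef j) (tensorS f g))
      = A.coef i f * B.coef j g := fun i j => by
    have : partialPairing (B.coef j) (tensorS f g) = B.coef j g • f := by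
      ext x
      have h : sliceCLM x (tensorS f g) = f x • g := by
        ext y
        rfl
      change B.coef j (sliceCLM x (tensorS f g)) = B.coef j g * f x
      rw [h, map_smul, smul_eq_mul, mul_comm]
    rw [this, map_smul, smul_eq_mul, mul_comm]
  -- Resumming in this order uses only separate continuity: first that of the distribution `T
  -- (B.atom j)`, which recovers `f`, then that of `g ↦ T g f`, which recovers `g`.
  have hs' := (Equiv.prodComm B.idx A.idx).summable_iff.2 hs
  calc _ = _ := (hL (tensorS f g)).tsum_eq.symm
    _ = ∑' i : B.idx × A.idx, A.coef i.2 (partialPairing (B.coef i.1) (tensorS f g)) *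
        T (B.atom i.1) (A.atom i.2) := ((Equiv.prodComm B.idx A.idx).tsum_eq _).symm
    _ = ∑' j, ∑' i, A.coef i (partialPairing (B.coef j) (tensorS f g)) *
        T (B.atom j) (A.atom i) := hs'.tsum_prod
    _ = ∑' j, B.coef j g * T (B.atom j) f := by
        congr 1
        ext j
        refine (tsum_congr fun i => ?_).trans (tsum_mul_left.trans (congrArg (B.coef j g * ·)
          (A.hasSum_apply (toDual (T (B.atom j))) f).tsum_eq))
        rw [hc]
        change _ * T (B.atom j) (A.atom i) = _ * (_ * T (B.atom j) (A.atom i))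
        ring
    _ = _ := (B.hasSum_apply ((toDual (PointwiseConvergenceCLM.evalCLM (RingHom.id ℂ) ℂ f ∘L T))) g).tsum_eq

end

/-- This is the uniqueness half of the kernel theorem: the atoms of a product system are pure
tensors, so equality on pure tensors suffices. -/
theorem eq_of_atom_eq {V : Type} [NormedAddCommGroup V] [NormedSpace ℝ V] (A : AtomicSystem V)
    {F G : 𝓢'(V, ℂ)} (h : ∀ i, F (A.atom i) = G (A.atom i)) : F = G := by
  ext f
  let toCLM : 𝓢'(V, ℂ) → 𝓢(V, ℂ) →L[ℂ] ℂ := fun F =>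
    { toFun := F
      map_add' := map_add F
      map_smul' := map_smul F
      cont := map_continuous F }
  have hF := A.hasSum_apply (toCLM F) f
  have hG := A.hasSum_apply (toCLM G) f
  have h' : ∀ i, toCLM F (A.atom i) = toCLM G (A.atom i) := h
  simp only [h'] at hF
  exact hF.unique hG

end AtomicSystem

/-! ### Translation and localization estimates -/

section translation
variable {E : Type*} [NormedAddCommGroup E] [NormedSpace ℝ E]

theorem schwartzNorm_compSubConst_le (N : ℕ) (a : E) (f : 𝓢(E, ℂ)) :
    schwartzNorm E N (compSubConstCLM ℂ a f) ≤ 2 ^ N * schwartzNorm E N f * (1 + ‖a‖) ^ N := by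
  have hf0 := apply_nonneg (schwartzNorm E N) f
  refine schwartzNorm_le (by positivity) fun k hk n hn x => ?_
  have h1 : iteratedFDeriv ℝ n (compSubConstCLM ℂ a f) x = iteratedFDeriv ℝ n f (x - a) :=
    iteratedFDeriv_comp_sub n a x
  have h2 : ‖x‖ ≤ (1 + ‖x - a‖) * (1 + ‖a‖) := by
    have := norm_add_le (x - a) a
    rw [sub_add_cancel] at this
    nlinarith [norm_nonneg (x - a), norm_nonneg a]
  rw [h1]
  calc _ ≤ ((1 + ‖x - a‖) * (1 + ‖a‖)) ^ k * ‖iteratedFDeriv ℝ n f (x - a)‖ := by gcongr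
    _ = (1 + ‖x - a‖) ^ k * ‖iteratedFDeriv ℝ n f (x - a)‖ * (1 + ‖a‖) ^ k := by
      rw [mul_pow]; ring
    _ ≤ 2 ^ N * schwartzNorm E N f * (1 + ‖a‖) ^ N :=
      mul_le_mul (one_add_norm_pow_mul_le hk hn f _)
        (pow_le_pow_right₀ (by linarith [norm_nonneg a]) hk) (by positivity) (by positivity)

/-- The localization `x ↦ ψ(x - a) f(x)`. -/
noncomputable def localize (ψ : 𝓢(E, ℂ)) (a : E) : 𝓢(E, ℂ) →L[ℂ] 𝓢(E, ℂ) :=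
  smulLeftCLM ℂ (compSubConstCLM ℂ a ψ)

theorem localize_apply (ψ : 𝓢(E, ℂ)) (a : E) (f : 𝓢(E, ℂ)) (x : E) :
    localize ψ a f x = ψ (x - a) * f x :=
  smulLeftCLM_apply_apply (compSubConstCLM ℂ a ψ).hasTemperateGrowth f x

/-- Since `1 + ‖a‖ ≤ (1 + ‖x - a‖)(1 + ‖x‖)`, powers of `1 + ‖a‖` are paid for by the decay of `ψ`
at `x - a` together with that of `f` at `x`. -/
theorem exists_schwartzNorm_localize_le (ψ : 𝓢(E, ℂ)) (K N : ℕ) : ∃ (K' : ℕ) (C : ℝ), 0 ≤ C ∧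
    ∀ a f, (1 + ‖a‖) ^ N * schwartzNorm E K (localize ψ a f) ≤ C * schwartzNorm E K' f := by
  have hψ0 := apply_nonneg (schwartzNorm E (K + N)) ψ
  refine ⟨K + N, 2 ^ K * (2 ^ (K + N) * schwartzNorm E (K + N) ψ * 2 ^ (K + N)), by positivity,
    fun a f => ?_⟩
  have hf0 := apply_nonneg (schwartzNorm E (K + N)) f
  have ha : 0 < (1 + ‖a‖) ^ N := by positivity
  rw [mul_comm, ← le_div_iff₀ ha]
  refine schwartzNorm_le (by positivity) fun k hk n hn x => ?_
  rw [le_div_iff₀ ha]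
  have h1 : (⇑(localize ψ a f) : E → ℂ) = fun x => compSubConstCLM ℂ a ψ x * f x := by
    ext x
    rw [localize_apply]
    rfl
  have h2 : ∀ i, iteratedFDeriv ℝ i (compSubConstCLM ℂ a ψ) x = iteratedFDeriv ℝ i ψ (x - a) :=
    fun i => iteratedFDeriv_comp_sub i a x
  have hm := norm_iteratedFDeriv_mul_le ((compSubConstCLM ℂ a ψ).smooth ⊤) (f.smooth ⊤) x (n := n)
    (mod_cast le_top)
  have h3 : 1 + ‖a‖ ≤ (1 + ‖x - a‖) * (1 + ‖x‖) := by
    have := norm_sub_le x (x - a)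
    rw [sub_sub_cancel] at this
    nlinarith [norm_nonneg (x - a), norm_nonneg x]
  rw [h1]
  calc _ ≤ (1 + ‖x‖) ^ k * (∑ i ∈ Finset.range (n + 1), (n.choose i : ℝ) *
        ‖iteratedFDeriv ℝ i (compSubConstCLM ℂ a ψ) x‖ * ‖iteratedFDeriv ℝ (n - i) f x‖) *
        ((1 + ‖x - a‖) * (1 + ‖x‖)) ^ N := by
        gcongr
        linarith
    _ = ∑ i ∈ Finset.range (n + 1), (n.choose i : ℝ) *
        (((1 + ‖x - a‖) ^ N * ‖iteratedFDeriv ℝ i ψ (x - a)‖) *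
        ((1 + ‖x‖) ^ (k + N) * ‖iteratedFDeriv ℝ (n - i) f x‖)) := by
        rw [mul_pow, pow_add, Finset.mul_sum, Finset.sum_mul]
        exact Finset.sum_congr rfl fun i _ => by rw [h2]; ring
    _ ≤ ∑ i ∈ Finset.range (n + 1), (n.choose i : ℝ) *
        ((2 ^ (K + N) * schwartzNorm E (K + N) ψ) * (2 ^ (K + N) * schwartzNorm E (K + N) f)) :=
      Finset.sum_le_sum fun i hi => by
        have := Finset.mem_range.1 hi
        exact mul_le_mul_of_nonneg_left (mul_le_mul
          (one_add_norm_pow_mul_le (by omega) (by omega) ψ _)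
          (one_add_norm_pow_mul_le (by omega) (by omega) f _) (by positivity) (by positivity))
          (Nat.cast_nonneg _)
    _ = 2 ^ n * ((2 ^ (K + N) * schwartzNorm E (K + N) ψ) *
        (2 ^ (K + N) * schwartzNorm E (K + N) f)) := by
        rw [← Finset.sum_mul]
        congr 1
        exact_mod_cast Nat.sum_range_choose n
    _ ≤ 2 ^ K * ((2 ^ (K + N) * schwartzNorm E (K + N) ψ) *
        (2 ^ (K + N) * schwartzNorm E (K + N) f)) := by
        gcongr
        norm_num
    _ = _ := by ring

end translation

/-! ### The Gabor system on the line, and atomic systems on Euclidean space -/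

theorem contDiff_transitionBump (a b : ℝ) : ContDiff ℝ ∞
    fun x : ℝ => ((Real.smoothTransition (4 * x + a) - Real.smoothTransition (4 * x + b) : ℝ) : ℂ) := by
  have h : ∀ c : ℝ, ContDiff ℝ ∞ fun x : ℝ => Real.smoothTransition (4 * x + c) := fun c =>
    Real.smoothTransition.contDiff.comp (by fun_prop)
  exact Complex.ofRealCLM.contDiff.comp ((h a).sub (h b))

theorem hasCompactSupport_transitionBump (a b : ℝ) : HasCompactSupport
    fun x : ℝ => ((Real.smoothTransition (4 * x + a) - Real.smoothTransition (4 * x + b) : ℝ) : ℂ) := by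
  refine HasCompactSupport.intro (isCompact_closedBall (0 : ℝ) (1 + |a| + |b|)) fun x hx => ?_
  rw [mem_closedBall_zero_iff, not_le, Real.norm_eq_abs] at hx
  have ha := abs_le.1 (le_refl |a|)
  have hb := abs_le.1 (le_refl |b|)
  have ha0 := abs_nonneg a
  have hb0 := abs_nonneg b
  rcases lt_abs.1 hx with h | h
  · rw [Real.smoothTransition.one_of_one_le (by linarith),
      Real.smoothTransition.one_of_one_le (by linarith)]
    simp
  · rw [Real.smoothTransition.zero_of_nonpos (by linarith),
      Real.smoothTransition.zero_of_nonpos (by linarith)]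
    simp

/-- The bump function `x ↦ σ(4x + a) - σ(4x + b)`, with `σ` a smooth transition from `0` to `1`. -/
noncomputable def transitionBump (a b : ℝ) : 𝓢(ℝ, ℂ) :=
  (hasCompactSupport_transitionBump a b).toSchwartzMap (contDiff_transitionBump a b)

theorem transitionBump_apply (a b x : ℝ) : transitionBump a b x =
    ((Real.smoothTransition (4 * x + a) - Real.smoothTransition (4 * x + b) : ℝ) : ℂ) := rfl

/-- The sum telescopes. With `n = ⌊4x⌋` only `k = n` and `k = n + 1` contribute, and their total is
`σ(4x - n + 1) - σ(4x - n - 1) = 1 - 0`. -/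
theorem tsum_transitionBump (x : ℝ) : ∑' k : ℤ, transitionBump 1 0 (x - k / 4) = 1 := by
  let n := ⌊4 * x⌋
  have h1 : (n : ℝ) ≤ 4 * x := Int.floor_le _
  have h2 : 4 * x < n + 1 := Int.lt_floor_add_one _
  have e : ∀ k : ℤ, transitionBump 1 0 (x - k / 4) =
      ((Real.smoothTransition (4 * x - k + 1) - Real.smoothTransition (4 * x - k) : ℝ) : ℂ) := by
    intro k
    rw [transitionBump_apply]
    congr 3 <;> ring_nf
  have hz : ∀ k ∉ ({n, n + 1} : Finset ℤ), transitionBump 1 0 (x - k / 4) = 0 := by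
    intro k hk
    simp only [Finset.mem_insert, Finset.mem_singleton, not_or] at hk
    rw [e]
    rcases lt_or_gt_of_ne hk.1 with h | h
    · have : (k : ℝ) + 1 ≤ n := mod_cast h
      rw [Real.smoothTransition.one_of_one_le (by linarith),
        Real.smoothTransition.one_of_one_le (by linarith)]
      simp
    · have h' : n + 1 < k := by omega
      have : (n : ℝ) + 1 + 1 ≤ k := mod_cast h'
      rw [Real.smoothTransition.zero_of_nonpos (by linarith),
        Real.smoothTransition.zero_of_nonpos (by linarith)]
      simp
  rw [tsum_eq_sum hz, Finset.sum_pair (by omega), e, e]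
  rw [Real.smoothTransition.one_of_one_le (x := 4 * x - n + 1) (by linarith)]
  push_cast
  rw [Real.smoothTransition.zero_of_nonpos (x := 4 * x - (n + 1)) (by linarith)]
  rw [show 4 * x - (n + 1 : ℝ) + 1 = 4 * x - n by ring]
  simp

/-- The narrow bump vanishes outside `(-1/4, 1/4)`. The wide bump equals `1` there and vanishes
outside `(-1/2, 1/2)`, so it misses every other integer translate of the narrow one. It thus
extracts a single term from a periodization. -/
theorem transitionBump_mul (x : ℝ) (l : ℤ) : transitionBump 2 (-1) x * transitionBump 1 0 (x + l) =
    if l = 0 then transitionBump 1 0 x else 0 := by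
  have h0 : ∀ x : ℝ, x ≤ -1 / 4 ∨ 1 / 4 ≤ x → transitionBump 1 0 x = 0 := by
    rintro x (h | h)
    · rw [transitionBump_apply, Real.smoothTransition.zero_of_nonpos (by linarith),
        Real.smoothTransition.zero_of_nonpos (by linarith)]
      simp
    · rw [transitionBump_apply, Real.smoothTransition.one_of_one_le (by linarith),
        Real.smoothTransition.one_of_one_le (by linarith)]
      simp
  have h1 : ∀ x : ℝ, x ≤ -1 / 2 ∨ 1 / 2 ≤ x → transitionBump 2 (-1) x = 0 := by
    rintro x (h | h)
    · rw [transitionBump_apply, Real.smoothTransition.zero_of_nonpos (by linarith),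
        Real.smoothTransition.zero_of_nonpos (by linarith)]
      simp
    · rw [transitionBump_apply, Real.smoothTransition.one_of_one_le (by linarith),
        Real.smoothTransition.one_of_one_le (by linarith)]
      simp
  split_ifs with hl
  · subst hl
    rw [Int.cast_zero, add_zero]
    by_cases h : x ≤ -1 / 4 ∨ 1 / 4 ≤ x
    · rw [h0 x h, mul_zero]
    · push Not at h
      rw [transitionBump_apply 2, Real.smoothTransition.one_of_one_le (by linarith),
        Real.smoothTransition.zero_of_nonpos (x := 4 * x + -1) (by linarith)]
      simp
  · by_cases h : x ≤ -1 / 2 ∨ 1 / 2 ≤ x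
    · rw [h1 x h, zero_mul]
    · push Not at h
      rw [h0 (x + l), mul_zero]
      rcases lt_or_gt_of_ne hl with h' | h'
      · left
        have : (l : ℝ) ≤ -1 := mod_cast (by omega : l ≤ -1)
        linarith
      · right
        have : (1 : ℝ) ≤ l := mod_cast (by omega : 1 ≤ l)
        linarith

/-- The time-frequency shift of a Schwartz function on the line by `(a, m)`. -/
noncomputable def gaborShift (a m : ℝ) (f : 𝓢(ℝ, ℂ)) : 𝓢(ℝ, ℂ) :=
  𝓕⁻ (compSubConstCLM ℂ m (𝓕 (compSubConstCLM ℂ a f)))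

/-- Translation of the Fourier transform is modulation. Defining the shift on the Fourier side
reduces its norm bounds to those of translations and to continuity of the Fourier transform. -/
theorem gaborShift_apply (a m : ℝ) (f : 𝓢(ℝ, ℂ)) (x : ℝ) :
    gaborShift a m f x = Complex.exp (2 * Real.pi * Complex.I * m * x) * f (x - a) := by
  have h1 : f (x - a) = 𝓕⁻ (𝓕 (compSubConstCLM ℂ a f)) x := by
    rw [FourierTransform.fourierInv_fourier_eq]
    rfl
  rw [h1, gaborShift, fourierInv_coe, fourierInv_coe, Real.fourierInv_eq', Real.fourierInv_eq',
    ← integral_const_mul,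
    ← integral_add_right_eq_self (fun v : ℝ => Complex.exp (↑(2 * Real.pi * inner ℝ v x) * Complex.I) •
      (compSubConstCLM ℂ m (𝓕 (compSubConstCLM ℂ a f))) v) m]
  congr 1
  ext v
  rw [compSubConstCLM_apply, add_sub_cancel_right, smul_eq_mul, smul_eq_mul, ← mul_assoc,
    ← Complex.exp_add]
  congr 2
  simp only [RCLike.inner_apply, conj_trivial]
  push_cast
  ring

theorem exists_schwartzNorm_gaborShift_le (f : 𝓢(ℝ, ℂ)) (N : ℕ) : ∃ (M : ℕ) (C : ℝ), 0 ≤ C ∧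
    ∀ a m, schwartzNorm ℝ N (gaborShift a m f) ≤ C * ((1 + ‖a‖) * (1 + ‖m‖)) ^ M := by
  obtain ⟨K₁, C₁, h1, hC₁⟩ := exists_schwartzNorm_map_le
    (FourierTransform.fourierInvCLM ℂ 𝓢(ℝ, ℂ)) N
  obtain ⟨K₂, C₂, h2, hC₂⟩ := exists_schwartzNorm_map_le
    (FourierTransform.fourierCLM ℂ 𝓢(ℝ, ℂ)) K₁
  have hf0 := apply_nonneg (schwartzNorm ℝ K₂) f
  refine ⟨max K₁ K₂, C₁ * (2 ^ K₁ * (C₂ * (2 ^ K₂ * schwartzNorm ℝ K₂ f))), by positivity,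
    fun a m => ?_⟩
  have ha : (1 : ℝ) ≤ 1 + ‖a‖ := by linarith [norm_nonneg a]
  have hm : (1 : ℝ) ≤ 1 + ‖m‖ := by linarith [norm_nonneg m]
  calc _ ≤ C₁ * schwartzNorm ℝ K₁ (compSubConstCLM ℂ m (𝓕 (compSubConstCLM ℂ a f))) := hC₁ _
    _ ≤ C₁ * (2 ^ K₁ * schwartzNorm ℝ K₁ (𝓕 (compSubConstCLM ℂ a f)) * (1 + ‖m‖) ^ K₁) := by
        gcongr
        exact schwartzNorm_compSubConst_le _ _ _
    _ ≤ C₁ * (2 ^ K₁ * (C₂ * (2 ^ K₂ * schwartzNorm ℝ K₂ f * (1 + ‖a‖) ^ K₂)) * (1 + ‖m‖) ^ K₁) := by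
        gcongr
        exact (hC₂ _).trans (mul_le_mul_of_nonneg_left (schwartzNorm_compSubConst_le _ _ _) h2)
    _ = C₁ * (2 ^ K₁ * (C₂ * (2 ^ K₂ * schwartzNorm ℝ K₂ f))) *
        ((1 + ‖a‖) ^ K₂ * (1 + ‖m‖) ^ K₁) := by ring
    _ ≤ _ := by
        rw [mul_pow]
        gcongr
        · exact le_max_right _ _
        · exact le_max_left _ _

/-- The Gabor coefficient `∫ ψ(x - k / 4) f(x) e^{-2πimx} dx`. -/
noncomputable def gaborCoef (ψ : 𝓢(ℝ, ℂ)) (i : ℤ × ℤ) : 𝓢(ℝ, ℂ) →L[ℂ] ℂ :=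
  toDual (TemperedDistribution.delta (i.2 : ℝ)) ∘L FourierTransform.fourierCLM ℂ 𝓢(ℝ, ℂ) ∘L
    localize ψ (i.1 / 4)

theorem gaborCoef_apply (ψ : 𝓢(ℝ, ℂ)) (i : ℤ × ℤ) (f : 𝓢(ℝ, ℂ)) :
    gaborCoef ψ i f = 𝓕 (localize ψ (i.1 / 4) f) (i.2 : ℝ) := rfl

/-- Decay in the position index comes from localization, decay in the frequency index from the
Schwartz decay of the Fourier transform. The factor `4 ^ N` reflects the lattice spacing `1/4`. -/
theorem exists_gaborCoef_le (ψ : 𝓢(ℝ, ℂ)) (N : ℕ) : ∃ (K : ℕ) (C : ℝ), 0 ≤ C ∧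
    ∀ i f, ((1 + |(i.1 : ℝ)|) * (1 + |(i.2 : ℝ)|)) ^ N * ‖gaborCoef ψ i f‖
      ≤ C * schwartzNorm ℝ K f := by
  obtain ⟨K₂, C₂, h2, hC₂⟩ := exists_schwartzNorm_map_le
    (FourierTransform.fourierCLM ℂ 𝓢(ℝ, ℂ)) N
  obtain ⟨K, C, h, hC⟩ := exists_schwartzNorm_localize_le ψ K₂ N
  refine ⟨K, 4 ^ N * (2 ^ N * (C₂ * C)), by positivity, fun i f => ?_⟩
  have hk : 1 + |(i.1 : ℝ)| ≤ 4 * (1 + ‖(i.1 : ℝ) / 4‖) := by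
    rw [Real.norm_eq_abs, abs_div, abs_of_pos (by norm_num : (0 : ℝ) < 4)]
    linarith
  have h3 := one_add_norm_pow_mul_le le_rfl (Nat.zero_le N) (𝓕 (localize ψ (i.1 / 4) f)) (i.2 : ℝ)
  rw [norm_iteratedFDeriv_zero] at h3
  rw [gaborCoef_apply]
  calc _ = (1 + |(i.1 : ℝ)|) ^ N * ((1 + ‖(i.2 : ℝ)‖) ^ N *
        ‖𝓕 (localize ψ (i.1 / 4) f) (i.2 : ℝ)‖) := by rw [mul_pow]; simp only [Real.norm_eq_abs]; ring
    _ ≤ (4 * (1 + ‖(i.1 : ℝ) / 4‖)) ^ N * (2 ^ N * (C₂ * schwartzNorm ℝ K₂ (localize ψ (i.1 / 4) f))) :=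
        mul_le_mul (pow_le_pow_left₀ (by positivity) hk _)
          (h3.trans (mul_le_mul_of_nonneg_left (hC₂ _) (by positivity))) (by positivity)
          (by positivity)
    _ = 4 ^ N * (2 ^ N * (C₂ * ((1 + ‖(i.1 : ℝ) / 4‖) ^ N *
        schwartzNorm ℝ K₂ (localize ψ (i.1 / 4) f)))) := by rw [mul_pow]; ring
    _ ≤ 4 ^ N * (2 ^ N * (C₂ * (C * schwartzNorm ℝ K f))) := by
        refine mul_le_mul_of_nonneg_left (mul_le_mul_of_nonneg_left
          (mul_le_mul_of_nonneg_left (hC _ f) h2) (by positivity)) (by positivity)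
    _ = _ := by ring

theorem summable_gaborWeight :
    Summable fun i : ℤ × ℤ => (((1 + |(i.1 : ℝ)|) * (1 + |(i.2 : ℝ)|)) ^ 2)⁻¹ := by
  have h : Summable fun k : ℤ => ((1 + |(k : ℝ)|) ^ 2)⁻¹ := by
    have h1 : Summable fun k : ℤ => 1 / (k : ℝ) ^ 2 :=
      Real.summable_one_div_int_pow.2 one_lt_two
    refine Summable.of_norm_bounded_eventually h1 ?_
    filter_upwards [(Set.finite_singleton (0 : ℤ)).compl_mem_cofinite] with k hk
    have hk' : (k : ℝ) ≠ 0 := by simpa using hk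
    have : 0 < (k : ℝ) ^ 2 := by positivity
    rw [Real.norm_of_nonneg (by positivity), one_div]
    exact inv_anti₀ this (by nlinarith [sq_abs (k : ℝ), abs_nonneg (k : ℝ)])
  refine (h.mul_of_nonneg h (fun k => by positivity) (fun k => by positivity)).congr fun i => ?_
  rw [mul_pow, mul_inv]

/-- For each `k` the sum over frequencies is the Fourier series of the periodization of the piece
`ψ(· - k/4) f`, and multiplication by the wide bump recovers that piece. The pieces add up to `f`
because the narrow bumps form a partition of unity. -/
theorem tsum_gabor (f : 𝓢(ℝ, ℂ)) (x : ℝ) :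
    ∑' i : ℤ × ℤ, gaborCoef (transitionBump 1 0) i f *
      gaborShift (i.1 / 4) i.2 (transitionBump 2 (-1)) x = f x := by
  set ψ := transitionBump 1 0
  set η := transitionBump 2 (-1)
  obtain ⟨K, C, hC, h⟩ := exists_gaborCoef_le ψ 2
  have hs : Summable fun i : ℤ × ℤ => gaborCoef ψ i f * gaborShift (i.1 / 4) i.2 η x := by
    refine Summable.of_norm_bounded (summable_gaborWeight.mul_left
      (C * schwartzNorm ℝ K f * SchwartzMap.seminorm ℂ 0 0 η)) fun i => ?_
    have h1 : ‖gaborShift (i.1 / 4) i.2 η x‖ ≤ SchwartzMap.seminorm ℂ 0 0 η := by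
      rw [gaborShift_apply, norm_mul, show (2 * Real.pi * Complex.I * (i.2 : ℝ) * x : ℂ)
        = ((2 * Real.pi * i.2 * x : ℝ) : ℂ) * Complex.I by push_cast; ring,
        Complex.norm_exp_ofReal_mul_I, one_mul]
      exact norm_le_seminorm ℂ η _
    have h2 := h i f
    rw [norm_mul, ← div_eq_mul_inv, le_div_iff₀ (by positivity)]
    calc _ ≤ ‖gaborCoef ψ i f‖ * SchwartzMap.seminorm ℂ 0 0 η *
          ((1 + |(i.1 : ℝ)|) * (1 + |(i.2 : ℝ)|)) ^ 2 := by gcongr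
      _ = ((1 + |(i.1 : ℝ)|) * (1 + |(i.2 : ℝ)|)) ^ 2 * ‖gaborCoef ψ i f‖ *
          SchwartzMap.seminorm ℂ 0 0 η := by ring
      _ ≤ _ := by gcongr
  calc _ = ∑' k : ℤ, ∑' m : ℤ, gaborCoef ψ (k, m) f * gaborShift (k / 4) m η x := hs.tsum_prod
    _ = ∑' k : ℤ, ψ (x - k / 4) * f x := by
        congr 1
        ext k
        have h1 : ∀ m : ℤ, gaborCoef ψ (k, m) f * gaborShift (k / 4) m η x =
            η (x - k / 4) * (𝓕 (localize ψ (k / 4) f) (m : ℝ) * fourier m (x : UnitAddCircle)) := by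
          intro m
          rw [gaborCoef_apply, gaborShift_apply, fourier_coe_apply]
          push_cast
          rw [div_one]
          ring
        simp only [h1]
        -- Poisson summation: the Fourier series with coefficients `𝓕(ψ_k f)(m)` is the sum of the
        -- integer translates of `ψ_k f`.
        have h2 := SchwartzMap.tsum_eq_tsum_fourier (localize ψ (k / 4) f) x
        rw [tsum_mul_left]
        refine (congrArg _ h2.symm).trans ?_
        rw [← tsum_mul_left]
        have h3 : ∀ l : ℤ, η (x - k / 4) * localize ψ (k / 4) f (x + l)
            = if l = 0 then ψ (x - k / 4) * f x else 0 := by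
          intro l
          rw [localize_apply, ← mul_assoc, show x + l - (k : ℝ) / 4 = x - k / 4 + l by ring,
            transitionBump_mul]
          split_ifs with hl
          · simp [hl, ψ]
          · simp
        simp only [h3]
        exact tsum_ite_eq 0 _
    _ = f x := by rw [tsum_mul_right, tsum_transitionBump, one_mul]

/-- The Gabor decomposition of Schwartz functions on the line. -/
noncomputable def gaborSystem : AtomicSystem ℝ where
  idx := ℤ × ℤ
  weight i := (1 + |(i.1 : ℝ)|) * (1 + |(i.2 : ℝ)|)
  one_le_weight i := one_le_mul_of_one_le_of_one_le (by simp) (by simp)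
  summable_weight := ⟨2, summable_gaborWeight⟩
  atom i := gaborShift (i.1 / 4) i.2 (transitionBump 2 (-1))
  atom_le N := by
    obtain ⟨M, C, hC, h⟩ := exists_schwartzNorm_gaborShift_le (transitionBump 2 (-1)) N
    refine ⟨M, C, hC, fun i => (h _ _).trans ?_⟩
    simp only [Real.norm_eq_abs, abs_div]
    gcongr
    exact div_le_self (abs_nonneg _) (by norm_num)
  coef := gaborCoef (transitionBump 1 0)
  coef_le := exists_gaborCoef_le _
  tsum_eq := tsum_gabor

/-- The atomic system of a trivial space. -/
noncomputable def AtomicSystem.ofSubsingleton (V : Type) [NormedAddCommGroup V]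
    [InnerProductSpace ℝ V] [Subsingleton V] : AtomicSystem V where
  idx := Unit
  weight _ := 1
  one_le_weight _ := le_rfl
  summable_weight := ⟨0, Summable.of_finite⟩
  atom _ := (HasCompactSupport.of_compactSpace fun _ : V => (1 : ℂ)).toSchwartzMap contDiff_const
  atom_le N := ⟨0, _, apply_nonneg _ _, fun _ => (mul_one _).ge⟩
  coef _ := toDual (TemperedDistribution.delta (0 : V))
  coef_le N := by
    obtain ⟨K, C, hC, h⟩ := exists_norm_apply_le (toDual (TemperedDistribution.delta (0 : V)))
    exact ⟨K, C, hC, fun _ f => by simpa using h f⟩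
  tsum_eq f x := by
    rw [tsum_fintype, Finset.sum_const]
    change 1 • (f 0 * 1) = _
    rw [Subsingleton.elim x 0]
    simp

theorem nonempty_atomicSystem_euclideanSpace (n : ℕ) :
    Nonempty (AtomicSystem (EuclideanSpace ℝ (Fin n))) := by
  induction n with
  | zero => exact ⟨AtomicSystem.ofSubsingleton _⟩
  | succ n ih =>
    obtain ⟨A⟩ := ih
    -- Any linear isomorphism will do: transport of atomic systems does not require an isometry.
    let e : EuclideanSpace ℝ (Fin (n + 1)) ≃L[ℝ] WithLp 2 (ℝ × EuclideanSpace ℝ (Fin n)) :=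
      ContinuousLinearEquiv.ofFinrankEq (by
        rw [(WithLp.linearEquiv 2 ℝ (ℝ × EuclideanSpace ℝ (Fin n))).finrank_eq]
        simp [add_comm])
    exact ⟨(gaborSystem.prod A).map e⟩

/-! ### Volume-preserving substitutions, conjugation, and the Schwartz kernel of an operator -/

theorem abs_det_eq_one_of_involutive {E : Type*} [AddCommGroup E] [Module ℝ E] (f : E →ₗ[ℝ] E)
    (hf : f ∘ₗ f = LinearMap.id) : |LinearMap.det f| = 1 := by
  have h : LinearMap.det f * LinearMap.det f = 1 := by
    rw [← LinearMap.det_comp, hf, LinearMap.det_id]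
  rcases mul_self_eq_one_iff.1 h with h | h <;> simp [h]

section
variable {V : Type} [NormedAddCommGroup V] [InnerProductSpace ℝ V]

/-- The map factors into three involutions, each of determinant `±1`: `(x, t) ↦ (x, -t)`, then `(a,
b) ↦ (a - b/2, -b)`, then `(a, b) ↦ (a, a - b)`. No block determinant has to be computed. -/
theorem abs_det_wignerEquiv :
    |((wignerEquiv V : WithLp 2 (V × V) ≃L[ℝ] WithLp 2 (V × V)) :
      WithLp 2 (V × V) →L[ℝ] WithLp 2 (V × V)).det| = 1 := by
  let a := LinearMap.fst ℝ V V
  let b := LinearMap.snd ℝ V V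
  let r₀ : V × V →ₗ[ℝ] V × V := a.prod (-b)
  let r₁ : V × V →ₗ[ℝ] V × V := (a - (1 / 2 : ℝ) • b).prod (-b)
  let r₂ : V × V →ₗ[ℝ] V × V := a.prod (a - b)
  have h : (((wignerEquiv V : WithLp 2 (V × V) ≃L[ℝ] WithLp 2 (V × V)) :
      WithLp 2 (V × V) →L[ℝ] WithLp 2 (V × V)) : WithLp 2 (V × V) →ₗ[ℝ] WithLp 2 (V × V)) =
      (WithLp.linearEquiv 2 ℝ (V × V)).symm ∘ₗ (r₂ ∘ₗ r₁ ∘ₗ r₀) ∘ₗ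
        (WithLp.linearEquiv 2 ℝ (V × V)).symm.symm := by
    refine LinearMap.ext fun p => ?_
    change WithLp.toLp 2 (p.fst + (1 / 2 : ℝ) • p.snd, p.fst - (1 / 2 : ℝ) • p.snd) =
      WithLp.toLp 2 (p.fst - (1 / 2 : ℝ) • -p.snd, p.fst - (1 / 2 : ℝ) • -p.snd - - -p.snd)
    congr 2 <;> module
  rw [ContinuousLinearMap.det, h, LinearMap.det_conj, LinearMap.det_comp, LinearMap.det_comp,
    abs_mul, abs_mul, abs_det_eq_one_of_involutive r₀, abs_det_eq_one_of_involutive r₁,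
    abs_det_eq_one_of_involutive r₂]
  · norm_num
  all_goals
    refine LinearMap.ext fun p => ?_
    ext <;> simp [r₀, r₁, r₂, a, b]

theorem abs_det_permEquiv :
    |((permEquiv V : _ ≃L[ℝ] _) : WithLp 2 (WithLp 2 (V × V) × WithLp 2 (V × V)) →L[ℝ]
      WithLp 2 (WithLp 2 (V × V) × WithLp 2 (V × V))).det| = 1 :=
  abs_det_eq_one_of_involutive _ (LinearMap.ext fun p => (permEquiv V).left_inv p)

theorem compD_apply_of_abs_det {A : V ≃L[ℝ] V} (hA : |(A : V →L[ℝ] V).det| = 1) (F : 𝓢'(V, ℂ))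
    (φ : 𝓢(V, ℂ)) : compD A F φ = F (compCLMOfContinuousLinearEquiv ℂ A.symm φ) := by
  change ((|(A : V →L[ℝ] V).det|⁻¹ : ℝ) : ℂ) * F _ = _
  rw [hA]
  simp

theorem conjS_conjS (f : 𝓢(V, ℂ)) : conjS (conjS f) = f := by
  ext x
  simp [conjS_apply]

theorem conjS_comp {V' : Type} [NormedAddCommGroup V'] [InnerProductSpace ℝ V'] (A : V' ≃L[ℝ] V)
    (f : 𝓢(V, ℂ)) : conjS (compCLMOfContinuousLinearEquiv ℂ A f)
      = compCLMOfContinuousLinearEquiv ℂ A (conjS f) := rfl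

theorem comp_symm_comp (A : V ≃L[ℝ] V) (f : 𝓢(V, ℂ)) :
    compCLMOfContinuousLinearEquiv ℂ A.symm (compCLMOfContinuousLinearEquiv ℂ A f) = f := by
  ext x
  simp

theorem comp_comp_symm (A : V ≃L[ℝ] V) (f : 𝓢(V, ℂ)) :
    compCLMOfContinuousLinearEquiv ℂ A (compCLMOfContinuousLinearEquiv ℂ A.symm f) = f := by
  ext x
  simp

theorem conjS_tensorS {V₁ V₂ : Type} [NormedAddCommGroup V₁] [InnerProductSpace ℝ V₁]
    [NormedAddCommGroup V₂] [InnerProductSpace ℝ V₂] (f : 𝓢(V₁, ℂ)) (g : 𝓢(V₂, ℂ)) :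
    conjS (tensorS f g) = tensorS (conjS f) (conjS g) := by
  ext p
  exact map_mul (starRingEnd ℂ) _ _

section
variable {V₁ V₂ : Type} [NormedAddCommGroup V₁] [InnerProductSpace ℝ V₁]
  [NormedAddCommGroup V₂] [InnerProductSpace ℝ V₂]

theorem sliceCLM_conjS (Φ : 𝓢(WithLp 2 (V₁ × V₂), ℂ)) (x : V₁) :
    sliceCLM x (conjS Φ) = conjS (sliceCLM x Φ) := rfl

theorem ext_sliceCLM {Φ Ψ : 𝓢(WithLp 2 (V₁ × V₂), ℂ)} (h : ∀ x, sliceCLM x Φ = sliceCLM x Ψ) :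
    Φ = Ψ := by
  ext p
  exact DFunLike.congr_fun (h p.fst) p.snd

end

theorem conjD_apply (F : 𝓢'(V, ℂ)) (φ : 𝓢(V, ℂ)) : conjD F φ = (starRingEnd ℂ) (F (conjS φ)) := rfl

theorem bracket_tensorD_conjD [FiniteDimensional ℝ V] (F G : 𝓢'(V, ℂ)) (u v : 𝓢(V, ℂ)) :
    bracket (tensorD F (conjD G)) (tensorS u (conjS v)) =
      bracket F u * (starRingEnd ℂ) (bracket G v) := by
  rw [bracket, conjS_tensorS, tensorD_tensorS, conjD_apply, conjS_conjS]
  rfl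

theorem existsUnique_isSchwartzKernel [FiniteDimensional ℝ V] (A : AtomicSystem V)
    (T : 𝓢(V, ℂ) →L[ℂ] 𝓢'(V, ℂ)) :
    ∃! kT, IsSchwartzKernel T kT := by
  obtain ⟨K, hK⟩ := AtomicSystem.exists_kernel A A T
  refine ⟨K, fun f g => ?_, fun K' hK' => (A.prod A).eq_of_atom_eq fun i => ?_⟩
  · rw [bracket, bracket, conjS_tensorS, conjS_conjS, hK]
  -- Conjugating the first atom cancels the conjugation built into the bracket, so the identity
  -- becomes one about pure tensors of atoms.
  · have := hK' (A.atom i.2) (conjS (A.atom i.1))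
    rw [bracket, bracket, conjS_tensorS, conjS_conjS, conjS_conjS] at this
    exact this.symm.trans (hK _ _).symm

end

/-! ### Fubini, Plancherel, and operators preserving the inner product -/

section
variable {V₁ V₂ : Type} [NormedAddCommGroup V₁] [InnerProductSpace ℝ V₁]
  [NormedAddCommGroup V₂] [InnerProductSpace ℝ V₂] [FiniteDimensional ℝ V₁]
  [FiniteDimensional ℝ V₂] [MeasurableSpace V₁] [BorelSpace V₁] [MeasurableSpace V₂] [BorelSpace V₂]

theorem integral_withLp_prod {F : Type*} [NormedAddCommGroup F] [NormedSpace ℝ F]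
    {f : WithLp 2 (V₁ × V₂) → F} (hf : Integrable f) :
    ∫ p, f p = ∫ x : V₁, ∫ y : V₂, f (WithLp.toLp 2 (x, y)) := by
  have hm := WithLp.volume_preserving_toLp V₁ V₂
  have he : MeasurableEmbedding (WithLp.toLp 2 : V₁ × V₂ → WithLp 2 (V₁ × V₂)) :=
    (MeasurableEquiv.toLp 2 (V₁ × V₂)).measurableEmbedding
  rw [← hm.integral_comp he]
  exact integral_prod (fun z => f (WithLp.toLp 2 z)) ((hm.integrable_comp_emb he).2 hf)

theorem integral_withLp_prod_mul (f : V₁ → ℂ) (g : V₂ → ℂ) :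
    ∫ p : WithLp 2 (V₁ × V₂), f p.fst * g p.snd = (∫ x, f x) * ∫ y, g y := by
  have hm := WithLp.volume_preserving_toLp V₁ V₂
  have he : MeasurableEmbedding (WithLp.toLp 2 : V₁ × V₂ → WithLp 2 (V₁ × V₂)) :=
    (MeasurableEquiv.toLp 2 (V₁ × V₂)).measurableEmbedding
  rw [← hm.integral_comp he]
  exact integral_prod_mul f g

end

section
variable {V : Type} [NormedAddCommGroup V] [InnerProductSpace ℝ V] [FiniteDimensional ℝ V]
  [MeasurableSpace V] [BorelSpace V]

theorem integrable_mul (a b : 𝓢(V, ℂ)) : Integrable fun x => a x * b x := by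
  have : (fun x => a x * b x) = smulLeftCLM ℂ (⇑a) b := by
    ext x
    rw [smulLeftCLM_apply_apply a.hasTemperateGrowth]
    rfl
  rw [this]
  exact (smulLeftCLM ℂ (⇑a) b).integrable

theorem fourier_conjS (f : 𝓢(V, ℂ)) : 𝓕 (conjS f) = conjS (𝓕⁻ f) := by
  ext ξ
  rw [conjS_apply, fourierInv_coe, fourier_coe, Real.fourierInv_eq', Real.fourier_eq',
    ← integral_conj]
  congr 1
  ext v
  rw [smul_eq_mul, smul_eq_mul, map_mul, conjS_apply, ← Complex.exp_conj]
  congr 2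
  rw [map_mul, Complex.conj_ofReal, Complex.conj_I]
  push_cast
  ring

/-- A linear map of determinant `±1` is measure preserving. -/
theorem measurePreserving_of_abs_det {A : V ≃L[ℝ] V} (hA : |(A : V →L[ℝ] V).det| = 1) :
    MeasurePreserving A := by
  refine ⟨A.continuous.measurable, ?_⟩
  have h0 : LinearMap.det ((A : V →L[ℝ] V) : V →ₗ[ℝ] V) ≠ 0 := by
    intro h
    rw [ContinuousLinearMap.det, h] at hA
    simp at hA
  have := Measure.map_linearMap_addHaar_eq_smul_addHaar (volume : Measure V) h0
  rw [ContinuousLinearMap.det] at hA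
  rw [abs_inv, hA, inv_one, ENNReal.ofReal_one, one_smul] at this
  exact this

/-- A linear operator between Schwartz spaces that preserves the `L²` inner product. -/
def PreservesInner {V' : Type} [NormedAddCommGroup V'] [InnerProductSpace ℝ V']
    [FiniteDimensional ℝ V'] [MeasurableSpace V'] [BorelSpace V'] (U : 𝓢(V, ℂ) →L[ℂ] 𝓢(V', ℂ)) :
    Prop :=
  ∀ a b, ∫ x, U a x * conjS (U b) x = ∫ x, a x * conjS b x

theorem preservesInner_comp {A : V ≃L[ℝ] V} (hA : |(A : V →L[ℝ] V).det| = 1) :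
    PreservesInner (compCLMOfContinuousLinearEquiv ℂ A : 𝓢(V, ℂ) →L[ℂ] 𝓢(V, ℂ)) := fun a b =>
  (measurePreserving_of_abs_det hA).integral_comp A.toHomeomorph.measurableEmbedding
    (fun x => a x * conjS b x)

end

section
variable {V₁ V₂ : Type} [NormedAddCommGroup V₁] [InnerProductSpace ℝ V₁]
  [NormedAddCommGroup V₂] [InnerProductSpace ℝ V₂] [FiniteDimensional ℝ V₁]
  [FiniteDimensional ℝ V₂] [MeasurableSpace V₂] [BorelSpace V₂]

theorem sliceCLM_partialFourier (Φ : 𝓢(WithLp 2 (V₁ × V₂), ℂ)) (x : V₁) :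
    sliceCLM x (partialFourier Φ) = 𝓕 (sliceCLM x Φ) := rfl

/-- Fourier inversion on each slice, written without an inverse transform: the inverse of the
partial Fourier transform is its conjugate by complex conjugation. Plancherel, surjectivity and the
duality formulas all use it in this form. -/
theorem partialFourier_conjS_partialFourier (Φ : 𝓢(WithLp 2 (V₁ × V₂), ℂ)) :
    partialFourier (conjS (partialFourier Φ)) = conjS Φ := by
  refine ext_sliceCLM fun x => ?_
  rw [sliceCLM_partialFourier, sliceCLM_conjS, sliceCLM_partialFourier, fourier_conjS,
    FourierTransform.fourierInv_fourier_eq, sliceCLM_conjS]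

variable [MeasurableSpace V₁] [BorelSpace V₁]

theorem integral_partialFourier_mul (a b : 𝓢(WithLp 2 (V₁ × V₂), ℂ)) :
    ∫ p, partialFourier a p * b p = ∫ p, a p * partialFourier b p := by
  rw [integral_withLp_prod (integrable_mul _ _), integral_withLp_prod (integrable_mul _ _)]
  congr 1
  ext x
  exact integral_fourier_mul_eq (sliceCLM x a) (sliceCLM x b)

theorem preservesInner_partialFourier :
    PreservesInner (partialFourier : 𝓢(WithLp 2 (V₁ × V₂), ℂ) →L[ℂ] _) := fun a b => by
  rw [integral_partialFourier_mul, partialFourier_conjS_partialFourier]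

end

/-! ### The Wigner transform as a unitary bijection, and the Wigner kernel -/

section
variable {V : Type} [NormedAddCommGroup V] [InnerProductSpace ℝ V] [FiniteDimensional ℝ V]
  [MeasurableSpace V] [BorelSpace V]

/-- The Wigner transform `Φ ↦ ((x, ξ) ↦ ∫ Φ(x + t/2, x - t/2) e^{-2πi t·ξ} dt)` of a function of two
variables. -/
noncomputable def wignerTransform (V : Type) [NormedAddCommGroup V] [InnerProductSpace ℝ V]
    [FiniteDimensional ℝ V] [MeasurableSpace V] [BorelSpace V] :
    𝓢(WithLp 2 (V × V), ℂ) →L[ℂ] 𝓢(WithLp 2 (V × V), ℂ) :=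
  partialFourier ∘L compCLMOfContinuousLinearEquiv ℂ (wignerEquiv V)

theorem crossWigner_eq (f g : 𝓢(V, ℂ)) :
    crossWigner f g = wignerTransform V (tensorS f (conjS g)) := rfl

/-- The Wigner distribution of distributions is defined by transposition. Moved onto the test
function, the second partial Fourier transform cancels the first by inversion, and the substitution
cancels because its determinant is `±1`. -/
theorem bracket_crossWignerD (F G : 𝓢'(V, ℂ)) (Φ : 𝓢(WithLp 2 (V × V), ℂ)) :
    bracket (crossWignerD F G) (wignerTransform V Φ) = bracket (tensorD F (conjD G)) Φ := by
  change compD (wignerEquiv V) (tensorD F (conjD G)) (partialFourier (conjS (partialFourier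
    (compCLMOfContinuousLinearEquiv ℂ (wignerEquiv V) Φ)))) = tensorD F (conjD G) (conjS Φ)
  rw [compD_apply_of_abs_det abs_det_wignerEquiv, partialFourier_conjS_partialFourier, conjS_comp,
    comp_symm_comp]

theorem surjective_wignerTransform : Function.Surjective (wignerTransform V) := fun Θ => by
  refine ⟨compCLMOfContinuousLinearEquiv ℂ (wignerEquiv V).symm
    (conjS (partialFourier (conjS Θ))), ?_⟩
  change partialFourier (compCLMOfContinuousLinearEquiv ℂ (wignerEquiv V) _) = _
  rw [comp_comp_symm, partialFourier_conjS_partialFourier, conjS_conjS]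

theorem preservesInner_wignerTransform : PreservesInner (wignerTransform V) := fun a b =>
  (preservesInner_partialFourier _ _).trans (preservesInner_comp abs_det_wignerEquiv a b)

/-- The operator `𝔗_p W` on functions of two phase space variables. -/
noncomputable def permWigner (V : Type) [NormedAddCommGroup V] [InnerProductSpace ℝ V]
    [FiniteDimensional ℝ V] [MeasurableSpace V] [BorelSpace V] :
    𝓢(WithLp 2 (WithLp 2 (V × V) × WithLp 2 (V × V)), ℂ) →L[ℂ]
      𝓢(WithLp 2 (WithLp 2 (V × V) × WithLp 2 (V × V)), ℂ) :=
  compCLMOfContinuousLinearEquiv ℂ (permEquiv V) ∘L wignerTransform (WithLp 2 (V × V))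

/-- The key duality: every question about `𝔗_p W F` pulls back along the bijection `permWigner` to
one about `F ⊗ F̄`. -/
theorem bracket_compD_permEquiv (F : 𝓢'(WithLp 2 (V × V), ℂ))
    (H : 𝓢(WithLp 2 (WithLp 2 (V × V) × WithLp 2 (V × V)), ℂ)) :
    bracket (compD (permEquiv V) (crossWignerD F F)) (permWigner V H) =
      bracket (tensorD F (conjD F)) H := by
  rw [← bracket_crossWignerD, bracket, compD_apply_of_abs_det abs_det_permEquiv]
  change crossWignerD F F (compCLMOfContinuousLinearEquiv ℂ (permEquiv V).symm (conjS
    (compCLMOfContinuousLinearEquiv ℂ (permEquiv V) (wignerTransform _ H)))) = _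
  rw [conjS_comp, comp_symm_comp]
  rfl

theorem surjective_permWigner : Function.Surjective (permWigner V) := fun Θ => by
  obtain ⟨H, hH⟩ := surjective_wignerTransform (V := WithLp 2 (V × V))
    (compCLMOfContinuousLinearEquiv ℂ (permEquiv V).symm Θ)
  refine ⟨H, ?_⟩
  change compCLMOfContinuousLinearEquiv ℂ (permEquiv V) (wignerTransform _ H) = _
  rw [hH, comp_comp_symm]

theorem preservesInner_permWigner : PreservesInner (permWigner V) := fun a b =>
  (preservesInner_comp abs_det_permEquiv _ _).trans (preservesInner_wignerTransform a b)

/-- The Wigner integral over the doubled space factors into integrals in `t` and `s`. The second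
factor carries `f̄` and `ḡ` in place of `f` and `g`; the sign in `-η` conjugates its exponential
too, so that it becomes `conj W(f,g)`. -/
theorem permWigner_tensorS (f g u v : 𝓢(V, ℂ)) :
    permWigner V (tensorS (tensorS u (conjS f)) (conjS (tensorS v (conjS g)))) =
      tensorS (crossWigner u v) (conjS (crossWigner f g)) := by
  ext p
  obtain ⟨⟨x, ξ⟩, ⟨y, η⟩⟩ := p
  change crossWigner (tensorS u (conjS f)) (tensorS v (conjS g))
    (WithLp.toLp 2 (WithLp.toLp 2 (x, y), WithLp.toLp 2 (ξ, -η))) =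
    crossWigner u v (WithLp.toLp 2 (x, ξ)) * (starRingEnd ℂ) (crossWigner f g (WithLp.toLp 2 (y, η)))
  rw [crossWigner_apply, crossWigner_apply, crossWigner_apply, ← integral_conj,
    ← integral_withLp_prod_mul]
  congr 1
  ext q
  obtain ⟨t, s⟩ := q
  change (u (x + (1 / 2 : ℝ) • t) * (starRingEnd ℂ) (f (y + (1 / 2 : ℝ) • s))) *
    (starRingEnd ℂ) (v (x - (1 / 2 : ℝ) • t) * (starRingEnd ℂ) (g (y - (1 / 2 : ℝ) • s))) *
    Complex.exp (-(2 * Real.pi * Complex.I * ((inner ℝ t ξ + inner ℝ s (-η) : ℝ) : ℂ))) =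
    (u (x + (1 / 2 : ℝ) • t) * (starRingEnd ℂ) (v (x - (1 / 2 : ℝ) • t)) *
      Complex.exp (-(2 * Real.pi * Complex.I * (inner ℝ t ξ : ℝ)))) *
    (starRingEnd ℂ) (f (y + (1 / 2 : ℝ) • s) * (starRingEnd ℂ) (g (y - (1 / 2 : ℝ) • s)) *
      Complex.exp (-(2 * Real.pi * Complex.I * (inner ℝ s η : ℝ))))
  have h : Complex.exp (-(2 * Real.pi * Complex.I * ((inner ℝ t ξ + inner ℝ s (-η) : ℝ) : ℂ))) =
      Complex.exp (-(2 * Real.pi * Complex.I * (inner ℝ t ξ : ℝ))) *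
      (starRingEnd ℂ) (Complex.exp (-(2 * Real.pi * Complex.I * (inner ℝ s η : ℝ)))) := by
    rw [← Complex.exp_conj, ← Complex.exp_add, inner_neg_right]
    congr 1
    simp only [map_neg, map_mul, Complex.conj_ofReal, Complex.conj_I, map_ofNat]
    push_cast
    ring
  rw [h]
  simp only [map_mul]
  ring

/-- Moyal's identity, with distributions in the first slot. -/
theorem bracket_crossWignerD_crossWigner (F G : 𝓢'(V, ℂ)) (u v : 𝓢(V, ℂ)) :
    bracket (crossWignerD F G) (crossWigner u v) =
      bracket F u * (starRingEnd ℂ) (bracket G v) := by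
  rw [crossWigner_eq, bracket_crossWignerD, bracket_tensorD_conjD]

/-- Substitute `t ↦ -t`. In particular `W(g,g)` is real, which removes the conjugate from the
positivity statement. -/
theorem conjS_crossWigner (f g : 𝓢(V, ℂ)) : conjS (crossWigner f g) = crossWigner g f := by
  ext p
  obtain ⟨x, ξ⟩ := p
  change (starRingEnd ℂ) (crossWigner f g (WithLp.toLp 2 (x, ξ)))
    = crossWigner g f (WithLp.toLp 2 (x, ξ))
  rw [crossWigner_apply, crossWigner_apply, ← integral_conj, ← integral_neg_eq_self]
  congr 1
  ext t
  simp only [map_mul, Complex.conj_conj, ← Complex.exp_conj, smul_neg, sub_neg_eq_add,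
    ← sub_eq_add_neg, inner_neg_left, map_neg, Complex.conj_ofReal, Complex.conj_I, map_ofNat]
  rw [mul_comm ((starRingEnd ℂ) _)]
  congr 2
  push_cast
  ring

/-- `𝔗_p W k_T` is a Wigner kernel. -/
theorem isWignerKernel_of_isSchwartzKernel {T : 𝓢(V, ℂ) →L[ℂ] 𝓢'(V, ℂ)}
    {kT : 𝓢'(WithLp 2 (V × V), ℂ)} (h : IsSchwartzKernel T kT) :
    IsWignerKernel T (compD (permEquiv V) (crossWignerD kT kT)) := fun f g u v => by
  rw [← permWigner_tensorS, bracket_compD_permEquiv, bracket_tensorD_conjD,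
    bracket_crossWignerD_crossWigner, h f u, h g v]

/-- The defining identity fixes the pairing of `k` with the image under `permWigner` of every
fourfold pure tensor. These tensors determine a distribution, and `permWigner` is onto. -/
theorem IsWignerKernel.unique (A : AtomicSystem V) {T : 𝓢(V, ℂ) →L[ℂ] 𝓢'(V, ℂ)}
    {k k' : 𝓢'(WithLp 2 (WithLp 2 (V × V) × WithLp 2 (V × V)), ℂ)} (h : IsWignerKernel T k)
    (h' : IsWignerKernel T k') : k = k' := by
  -- The bracket is conjugate-linear in its test function. Applying `P` to `conjD k` gives `H ↦ conj
  -- ⟨k, permWigner H⟩`, a genuine tempered distribution to which uniqueness on atoms applies.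
  let P : 𝓢'(WithLp 2 (WithLp 2 (V × V) × WithLp 2 (V × V)), ℂ) →L[ℂ] _ :=
    PointwiseConvergenceCLM.precomp ℂ (permWigner V)
  have key : P (conjD k) = P (conjD k') := by
    refine ((A.prod A).prod (A.prod A)).eq_of_atom_eq fun i => ?_
    obtain ⟨⟨i, j⟩, ⟨l, m⟩⟩ := i
    have h1 : tensorS (tensorS (A.atom i) (A.atom j)) (tensorS (A.atom l) (A.atom m)) =
        tensorS (tensorS (A.atom i) (conjS (conjS (A.atom j))))
          (conjS (tensorS (conjS (A.atom l)) (conjS (A.atom m)))) := by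
      rw [conjS_tensorS, conjS_conjS, conjS_conjS, conjS_conjS]
    change conjD k (permWigner V (tensorS (tensorS (A.atom i) (A.atom j))
      (tensorS (A.atom l) (A.atom m)))) = conjD k' (permWigner V
        (tensorS (tensorS (A.atom i) (A.atom j)) (tensorS (A.atom l) (A.atom m))))
    rw [h1, permWigner_tensorS, conjD_apply, conjD_apply]
    exact congrArg _ ((h _ _ _ _).symm.trans (h' _ _ _ _))
  ext φ
  obtain ⟨H, hH⟩ := surjective_permWigner (conjS φ)
  have h2 : conjD k (permWigner V H) = conjD k' (permWigner V H) := DFunLike.congr_fun key H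
  rw [hH, conjD_apply, conjD_apply, conjS_conjS] at h2
  exact (starRingEnd ℂ).injective h2

theorem IsWignerKernel.nonneg {T : 𝓢(V, ℂ) →L[ℂ] 𝓢'(V, ℂ)}
    {k : 𝓢'(WithLp 2 (WithLp 2 (V × V) × WithLp 2 (V × V)), ℂ)} (h : IsWignerKernel T k)
    (f g : 𝓢(V, ℂ)) : bracket k (tensorS (crossWigner f f) (crossWigner g g)) =
      ((‖bracket (T g) f‖ ^ 2 : ℝ) : ℂ) := by
  rw [← conjS_crossWigner g g, ← h g g f f, bracket_crossWignerD_crossWigner, Complex.mul_conj,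
    Complex.normSq_eq_norm_sq]

end

/-! ### Square-integrable and Schwartz distributions under unitary maps and tensor products -/

theorem exists_conjD_apply_ne_zero {V : Type} [NormedAddCommGroup V] [InnerProductSpace ℝ V]
    {F : 𝓢'(V, ℂ)} (hF : F ≠ 0) :
    ∃ g, conjD F g ≠ 0 := by
  by_contra! h
  refine hF ?_
  ext φ
  have := h (conjS φ)
  rwa [conjD_apply, conjS_conjS, map_eq_zero] at this

section
variable {V : Type} [NormedAddCommGroup V] [InnerProductSpace ℝ V] [FiniteDimensional ℝ V]
  [MeasurableSpace V] [BorelSpace V]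

theorem inner_toLp_toLp (f g : 𝓢(V, ℂ)) :
    inner ℂ (f.toLp 2) (g.toLp 2) = ∫ x, g x * conjS f x := inner_toL2_toL2_eq f g

theorem norm_toLp_sq_eq_integral_mul_conjS (f : 𝓢(V, ℂ)) :
    ((‖f.toLp 2‖ ^ 2 : ℝ) : ℂ) = ∫ x, f x * conjS f x := by
  rw [← inner_toLp_toLp, inner_self_eq_norm_sq_to_K]
  push_cast
  rfl

theorem norm_toLp_sq (f : 𝓢(V, ℂ)) : ‖f.toLp 2‖ ^ 2 = ∫ x, ‖f x‖ ^ 2 := by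
  rw [← Complex.ofReal_inj, norm_toLp_sq_eq_integral_mul_conjS, ← integral_complex_ofReal]
  congr 1
  ext x
  rw [conjS_apply, Complex.mul_conj, Complex.normSq_eq_norm_sq]

theorem integrable_norm_sq (f : 𝓢(V, ℂ)) : Integrable fun x => ‖f x‖ ^ 2 := by
  refine (integrable_mul f (conjS f)).norm.congr (Eventually.of_forall fun x => ?_)
  simp only [norm_mul, conjS_apply, RCLike.norm_conj, sq]

theorem norm_toLp_conjS (f : 𝓢(V, ℂ)) : ‖(conjS f).toLp 2‖ = ‖f.toLp 2‖ := by
  rw [← sq_eq_sq₀ (norm_nonneg _) (norm_nonneg _), norm_toLp_sq, norm_toLp_sq]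
  simp only [conjS_apply, RCLike.norm_conj]

theorem PreservesInner.norm_toLp {V' : Type} [NormedAddCommGroup V'] [InnerProductSpace ℝ V']
    [FiniteDimensional ℝ V'] [MeasurableSpace V'] [BorelSpace V'] {U : 𝓢(V, ℂ) →L[ℂ] 𝓢(V', ℂ)}
    (hU : PreservesInner U) (f : 𝓢(V, ℂ)) : ‖(U f).toLp 2‖ = ‖f.toLp 2‖ := by
  rw [← sq_eq_sq₀ (norm_nonneg _) (norm_nonneg _), ← Complex.ofReal_inj,
    norm_toLp_sq_eq_integral_mul_conjS, norm_toLp_sq_eq_integral_mul_conjS, hU]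

theorem Lp_toTemperedDistribution_eq_inner (h : Lp ℂ 2 (volume : Measure V)) (φ : 𝓢(V, ℂ)) :
    Lp.toTemperedDistribution (star h) φ = inner ℂ h (φ.toLp 2) := by
  rw [Lp.toTemperedDistribution_apply, L2.inner_def]
  refine integral_congr_ae ?_
  filter_upwards [Lp.coeFn_star h, φ.coeFn_toLp 2] with x h1 h2
  rw [h1, h2, RCLike.inner_apply]
  rfl

/-- A tempered distribution is square integrable iff it is bounded for the `L²` norm. -/
theorem memL2_iff (F : 𝓢'(V, ℂ)) : MemL2 F ↔ ∃ C : ℝ, ∀ φ, ‖F φ‖ ≤ C * ‖φ.toLp 2‖ := by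
  constructor
  · rintro ⟨h, rfl⟩
    refine ⟨‖star h‖, fun φ => ?_⟩
    rw [← star_star h, Lp_toTemperedDistribution_eq_inner, star_star]
    exact norm_inner_le_norm _ _
  · rintro ⟨C, hC⟩
    -- Schwartz functions are dense in `L²`, so the bounded functional extends to `L²` and the Riesz
    -- theorem represents it.
    let F' : 𝓢(V, ℂ) →ₗ[ℂ] ℂ := (toDual F).toLinearMap
    let e : 𝓢(V, ℂ) →ₗ[ℂ] Lp ℂ 2 (volume : Measure V) :=
      (toLpCLM ℂ ℂ 2 (volume : Measure V)).toLinearMap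
    have he : DenseRange e :=
      denseRange_toLpCLM (E := V) (F := ℂ) (p := 2) (μ := volume) (by norm_num)
    let L := F'.extendOfNorm e
    -- The conjugate appears because the inner product conjugates its first argument, whereas a
    -- function acts on test functions bilinearly.
    refine ⟨star ((InnerProductSpace.toDual ℂ _).symm L), ?_⟩
    ext φ
    rw [Lp_toTemperedDistribution_eq_inner, InnerProductSpace.toDual_symm_apply]
    exact LinearMap.extendOfNorm_eq (f := F') (e := e) he ⟨C, hC⟩ φ

theorem memL2_iff_bracket (F : 𝓢'(V, ℂ)) :
    MemL2 F ↔ ∃ C : ℝ, ∀ φ, ‖bracket F φ‖ ≤ C * ‖φ.toLp 2‖ := by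
  rw [memL2_iff]
  refine exists_congr fun C => ⟨fun h φ => ?_, fun h φ => ?_⟩
  · rw [← norm_toLp_conjS]
    exact h _
  · have := h (conjS φ)
    rwa [norm_toLp_conjS, bracket, conjS_conjS] at this

theorem memSchwartz_iff (F : 𝓢'(V, ℂ)) :
    MemSchwartz F ↔ ∃ h : 𝓢(V, ℂ), ∀ φ, F φ = ∫ x, h x * φ x := by
  refine exists_congr fun h => ⟨?_, fun H => ?_⟩
  · rintro rfl φ
    rw [toTemperedDistributionCLM_apply_apply volume]
    simp only [smul_eq_mul, mul_comm]
  · ext φ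
    rw [toTemperedDistributionCLM_apply_apply volume, H]
    simp only [smul_eq_mul, mul_comm]

theorem memSchwartz_iff_bracket (F : 𝓢'(V, ℂ)) :
    MemSchwartz F ↔ ∃ h : 𝓢(V, ℂ), ∀ φ, bracket F φ = ∫ x, h x * conjS φ x := by
  rw [memSchwartz_iff]
  refine exists_congr fun h => ⟨fun H φ => H _, fun H φ => ?_⟩
  have := H (conjS φ)
  rwa [bracket, conjS_conjS] at this

section
variable {V' : Type} [NormedAddCommGroup V'] [InnerProductSpace ℝ V']
  [FiniteDimensional ℝ V'] [MeasurableSpace V'] [BorelSpace V'] {U : 𝓢(V, ℂ) →L[ℂ] 𝓢(V', ℂ)}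

/-- `U` is onto and preserves the `L²` norm, so the `L²` bounds for `F` and `G` hold with the same
constant. -/
theorem PreservesInner.memL2_iff (hU : PreservesInner U) (hs : Function.Surjective U)
    {F : 𝓢'(V, ℂ)} {G : 𝓢'(V', ℂ)} (h : ∀ φ, bracket G (U φ) = bracket F φ) :
    MemL2 G ↔ MemL2 F := by
  rw [memL2_iff_bracket, memL2_iff_bracket]
  refine exists_congr fun C => ?_
  rw [hs.forall]
  simp only [h, hU.norm_toLp]

/-- The densities correspond under `U`: `F` is given by `a` exactly when `G` is given by `U a`. -/
theorem PreservesInner.memSchwartz_iff (hU : PreservesInner U) (hs : Function.Surjective U)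
    {F : 𝓢'(V, ℂ)} {G : 𝓢'(V', ℂ)} (h : ∀ φ, bracket G (U φ) = bracket F φ) :
    MemSchwartz G ↔ MemSchwartz F := by
  rw [memSchwartz_iff_bracket, memSchwartz_iff_bracket, hs.exists]
  refine exists_congr fun a => ?_
  rw [hs.forall]
  simp only [h, hU a _]

end

theorem integral_tensorS {V₁ V₂ : Type} [NormedAddCommGroup V₁] [InnerProductSpace ℝ V₁]
    [NormedAddCommGroup V₂] [InnerProductSpace ℝ V₂] [FiniteDimensional ℝ V₁]
    [FiniteDimensional ℝ V₂] [MeasurableSpace V₁] [BorelSpace V₁] [MeasurableSpace V₂]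
    [BorelSpace V₂] (H : 𝓢(WithLp 2 (V₁ × V₂), ℂ)) (f : 𝓢(V₁, ℂ)) (g : 𝓢(V₂, ℂ)) :
    ∫ p, H p * tensorS f g p = ∫ x, (∫ y, sliceCLM x H y * g y) * f x := by
  rw [integral_withLp_prod (integrable_mul _ _)]
  congr 1
  ext x
  rw [← integral_mul_const]
  congr 1
  ext y
  change H _ * (f x * g y) = H _ * g y * f x
  ring

theorem norm_toLp_tensorS {V₁ V₂ : Type} [NormedAddCommGroup V₁] [InnerProductSpace ℝ V₁]
    [NormedAddCommGroup V₂] [InnerProductSpace ℝ V₂] [FiniteDimensional ℝ V₁]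
    [FiniteDimensional ℝ V₂] [MeasurableSpace V₁] [BorelSpace V₁] [MeasurableSpace V₂]
    [BorelSpace V₂] (f : 𝓢(V₁, ℂ)) (g : 𝓢(V₂, ℂ)) :
    ‖(tensorS f g).toLp 2‖ = ‖f.toLp 2‖ * ‖g.toLp 2‖ := by
  rw [← sq_eq_sq₀ (norm_nonneg _) (by positivity), mul_pow, ← Complex.ofReal_inj,
    Complex.ofReal_mul, norm_toLp_sq_eq_integral_mul_conjS, norm_toLp_sq_eq_integral_mul_conjS,
    norm_toLp_sq_eq_integral_mul_conjS, ← integral_withLp_prod_mul]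
  congr 1
  ext p
  change f p.fst * g p.snd * (starRingEnd ℂ) (f p.fst * g p.snd) =
    f p.fst * (starRingEnd ℂ) (f p.fst) * (g p.snd * (starRingEnd ℂ) (g p.snd))
  rw [map_mul]
  ring

theorem memL2_conjD {F : 𝓢'(V, ℂ)} (hF : MemL2 F) : MemL2 (conjD F) := by
  obtain ⟨C, hC⟩ := (memL2_iff F).1 hF
  refine (memL2_iff _).2 ⟨C, fun φ => ?_⟩
  rw [conjD_apply, RCLike.norm_conj, ← norm_toLp_conjS]
  exact hC _

section
variable {V₂ : Type} [NormedAddCommGroup V₂] [InnerProductSpace ℝ V₂] [FiniteDimensional ℝ V₂]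
  [MeasurableSpace V₂] [BorelSpace V₂]

theorem integrable_integral_norm_sq (Φ : 𝓢(WithLp 2 (V × V₂), ℂ)) :
    Integrable fun x : V => ∫ y : V₂, ‖Φ (WithLp.toLp 2 (x, y))‖ ^ 2 := by
  have hm := WithLp.volume_preserving_toLp V V₂
  have he : MeasurableEmbedding (WithLp.toLp 2 : V × V₂ → WithLp 2 (V × V₂)) :=
    (MeasurableEquiv.toLp 2 (V × V₂)).measurableEmbedding
  have hi : Integrable ((fun p => ‖Φ p‖ ^ 2) ∘ (WithLp.toLp 2 : V × V₂ → WithLp 2 (V × V₂))) :=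
    (hm.integrable_comp_emb he).2 (integrable_norm_sq Φ)
  exact hi.integral_prod_left

/-- Apply the bound on `G` to each slice `Φ(x, ·)`, square, and integrate over `x` by Fubini. -/
theorem norm_toLp_partialPairing_le {G : 𝓢'(V₂, ℂ)} {D : ℝ} (hD0 : 0 ≤ D)
    (hD : ∀ g, ‖G g‖ ≤ D * ‖g.toLp 2‖) (Φ : 𝓢(WithLp 2 (V × V₂), ℂ)) :
    ‖(partialPairing (toDual G) Φ).toLp 2‖ ≤ D * ‖Φ.toLp 2‖ := by
  have hs : ∀ x, ‖partialPairing (toDual G) Φ x‖ ^ 2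
      ≤ D ^ 2 * ∫ y : V₂, ‖Φ (WithLp.toLp 2 (x, y))‖ ^ 2 := fun x => by
    have h2 := pow_le_pow_left₀ (norm_nonneg _) (hD (sliceCLM x Φ)) 2
    rw [mul_pow, norm_toLp_sq] at h2
    have e1 : partialPairing (toDual G) Φ x = G (sliceCLM x Φ) := rfl
    have e2 : ∀ y, sliceCLM x Φ y = Φ (WithLp.toLp 2 (x, y)) := fun y => rfl
    rw [e1]
    simpa only [e2] using h2
  have hc : ‖(partialPairing (toDual G) Φ).toLp 2‖ ^ 2 ≤ D ^ 2 * ‖Φ.toLp 2‖ ^ 2 := by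
    rw [norm_toLp_sq, norm_toLp_sq, integral_withLp_prod (integrable_norm_sq Φ),
      ← integral_const_mul]
    exact integral_mono (integrable_norm_sq _) ((integrable_integral_norm_sq Φ).const_mul _) hs
  rw [← mul_pow] at hc
  exact (pow_le_pow_iff_left₀ (norm_nonneg _) (mul_nonneg hD0 (norm_nonneg _)) two_ne_zero).1 hc

theorem memL2_tensorD {F : 𝓢'(V, ℂ)} {G : 𝓢'(V₂, ℂ)} (hF : MemL2 F) (hG : MemL2 G) :
    MemL2 (tensorD F G) := by
  obtain ⟨C, hC⟩ := (memL2_iff F).1 hF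
  obtain ⟨D, hD⟩ := (memL2_iff G).1 hG
  refine (memL2_iff _).2 ⟨|C| * |D|, fun Φ => ?_⟩
  have h := norm_toLp_partialPairing_le (abs_nonneg D)
    (fun g => (hD g).trans (mul_le_mul_of_nonneg_right (le_abs_self D) (norm_nonneg _))) Φ
  have e : tensorD F G Φ = F (partialPairing (toDual G) Φ) := rfl
  rw [e, mul_assoc]
  exact (hC _).trans (mul_le_mul (le_abs_self C) h (norm_nonneg _) (abs_nonneg _))

/-- Freezing `g` gives `F f = (F ⊗ G)(f ⊗ g) / G g`, and the `L²` norm of `f ⊗ g` is a product. -/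
theorem memL2_of_tensorD {F : 𝓢'(V, ℂ)} {G : 𝓢'(V₂, ℂ)} (h : MemL2 (tensorD F G))
    {g : 𝓢(V₂, ℂ)} (hg : G g ≠ 0) : MemL2 F := by
  obtain ⟨C, hC⟩ := (memL2_iff _).1 h
  refine (memL2_iff F).2 ⟨C * ‖g.toLp 2‖ / ‖G g‖, fun f => ?_⟩
  have h1 := hC (tensorS f g)
  rw [tensorD_tensorS, norm_mul, norm_toLp_tensorS] at h1
  rw [div_mul_eq_mul_div, le_div_iff₀ (norm_pos_iff.2 hg)]
  linarith

theorem memSchwartz_tensorD {F : 𝓢'(V, ℂ)} {G : 𝓢'(V₂, ℂ)} (hF : MemSchwartz F)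
    (hG : MemSchwartz G) : MemSchwartz (tensorD F G) := by
  obtain ⟨a, ha⟩ := (memSchwartz_iff F).1 hF
  obtain ⟨b, hb⟩ := (memSchwartz_iff G).1 hG
  refine (memSchwartz_iff _).2 ⟨tensorS a b, fun Φ => ?_⟩
  change F (partialPairing (toDual G) Φ) = _
  rw [ha]
  simp only [mul_comm (tensorS a b _)]
  rw [integral_tensorS]
  congr 1
  ext x
  have h1 : G (sliceCLM x Φ) = ∫ y, b y * sliceCLM x Φ y := hb _
  simp only [mul_comm (b _)] at h1
  rw [← h1, mul_comm]
  rfl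

/-- If `H` is the density of `F ⊗ G`, then that of `F` is `x ↦ (G g)⁻¹ ∫ H(x, y) g(y) dy`. -/
theorem memSchwartz_of_tensorD {F : 𝓢'(V, ℂ)} {G : 𝓢'(V₂, ℂ)} (h : MemSchwartz (tensorD F G))
    {g : 𝓢(V₂, ℂ)} (hg : G g ≠ 0) : MemSchwartz F := by
  obtain ⟨H, hH⟩ := (memSchwartz_iff _).1 h
  -- Viewing `g` as a distribution makes the integral over `y` a partial pairing, which is already
  -- known to be a Schwartz function of `x`.
  let γ : 𝓢'(V₂, ℂ) := toTemperedDistributionCLM V₂ ℂ volume g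
  refine (memSchwartz_iff F).2 ⟨(G g)⁻¹ • partialPairing (toDual γ) H, fun f => ?_⟩
  have h1 := hH (tensorS f g)
  rw [tensorD_tensorS, integral_tensorS] at h1
  have h2 : ∀ x, partialPairing (toDual γ) H x = ∫ y, sliceCLM x H y * g y :=
    fun x => toTemperedDistributionCLM_apply_apply volume g (sliceCLM x H)
  have h3 : ∀ x, ((G g)⁻¹ • partialPairing (toDual γ) H) x * f x
      = (G g)⁻¹ * ((∫ y, sliceCLM x H y * g y) * f x) := fun x => by
    rw [← h2, ← mul_assoc]
    rfl
  simp only [h3]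
  rw [integral_const_mul, ← h1]
  field_simp

end

theorem memL2_tensorD_conjD_iff (F : 𝓢'(V, ℂ)) : MemL2 (tensorD F (conjD F)) ↔ MemL2 F := by
  refine ⟨fun h => ?_, fun h => memL2_tensorD h (memL2_conjD h)⟩
  -- If `F = 0` there is no test function on which `conjD F` is nonzero, and membership is trivial.
  by_cases hF : F = 0
  · exact (memL2_iff F).2 ⟨0, fun φ => by subst hF; simp⟩
  · obtain ⟨g, hg⟩ := exists_conjD_apply_ne_zero hF
    exact memL2_of_tensorD h hg

theorem memSchwartz_conjD {F : 𝓢'(V, ℂ)} (hF : MemSchwartz F) : MemSchwartz (conjD F) := by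
  obtain ⟨a, ha⟩ := (memSchwartz_iff F).1 hF
  refine (memSchwartz_iff _).2 ⟨conjS a, fun φ => ?_⟩
  rw [conjD_apply, ha, ← integral_conj]
  simp only [map_mul, conjS_apply, Complex.conj_conj]

theorem memSchwartz_tensorD_conjD_iff (F : 𝓢'(V, ℂ)) :
    MemSchwartz (tensorD F (conjD F)) ↔ MemSchwartz F := by
  refine ⟨fun h => ?_, fun h => memSchwartz_tensorD h (memSchwartz_conjD h)⟩
  by_cases hF : F = 0
  · exact (memSchwartz_iff F).2 ⟨0, fun φ => by subst hF; simp⟩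
  · obtain ⟨g, hg⟩ := exists_conjD_apply_ne_zero hF
    exact memSchwartz_of_tensorD h hg

end

end WignerKernel

/-! ### The main theorem -/

theorem theorem1p3 (d : ℕ)
    (T : 𝓢(EuclideanSpace ℝ (Fin d), ℂ) →L[ℂ] 𝓢'(EuclideanSpace ℝ (Fin d), ℂ)) :
    (∃! kT, IsSchwartzKernel T kT) ∧
    (∃! k, IsWignerKernel T k) ∧
    ∀ kT k, IsSchwartzKernel T kT → IsWignerKernel T k →
      k = compD (permEquiv (EuclideanSpace ℝ (Fin d))) (crossWignerD kT kT) ∧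
      (∀ f g : 𝓢(EuclideanSpace ℝ (Fin d), ℂ),
        0 ≤ (bracket k (tensorS (crossWigner f f) (crossWigner g g))).re ∧
        (bracket k (tensorS (crossWigner f f) (crossWigner g g))).im = 0) ∧
      (MemL2 k ↔ MemL2 kT) ∧
      (MemSchwartz k ↔ MemSchwartz kT) := by
  obtain ⟨A⟩ := nonempty_atomicSystem_euclideanSpace d
  have hS := existsUnique_isSchwartzKernel A T
  obtain ⟨k₀, hk₀, -⟩ := id hS
  refine ⟨hS, ⟨_, isWignerKernel_of_isSchwartzKernel hk₀, fun k hk =>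
    hk.unique A (isWignerKernel_of_isSchwartzKernel hk₀)⟩, fun kT k hkT hk => ?_⟩
  have he := hk.unique A (isWignerKernel_of_isSchwartzKernel hkT)
  refine ⟨he, fun f g => ?_, ?_, ?_⟩
  · rw [hk.nonneg]
    exact ⟨by rw [Complex.ofReal_re]; positivity, Complex.ofReal_im _⟩
  -- Both equivalences pass along `permWigner` from `k` to `kT ⊗ conj kT`, and then to `kT` itself.
  · rw [he, preservesInner_permWigner.memL2_iff surjective_permWigner (bracket_compD_permEquiv kT),
      memL2_tensorD_conjD_iff]
  · rw [he, preservesInner_permWigner.memSchwartz_iff surjective_permWigner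
      (bracket_compD_permEquiv kT), memSchwartz_tensorD_conjD_iff]
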